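/- Let $A,Q\in\mathbb R^{n\times n}$, $B,L\in\mathbb R^{n\times m}$, $R\in\mathbb R^{m\times m}$, and $A_0^i\in\mathbb R^{n\times n}$, $B_0^i\in\mathbb R^{n\times m}$ for $1\le i\le r$. All matrices are real unless said otherwise. For symmetric $X,Y$ write $X\preceq Y$ if $Y-X$ is positive semidefinite (PSD). Put $$\Pi_{11}(X)=\sum_{i=1}^r A_0^{i\,T}XA_0^i,\quad \Pi_{12}(X)=\sum_{i=1}^r A_0^{i\,T}XB_0^i,\quad \Pi_{22}(X)=\sum_{i=1}^r B_0^{i\,T}XB_0^i,$$ $$Q_c(X)=Q+\Pi_{11}(X),\quad L_c(X)=L+\Pi_{12}(X),\quad R_c(X)=R+\Pi_{22}(X),$$ $$A_c(X)=A-BR_c(X)^{-1}L_c(X)^T,\quad G_c(X)=BR_c(X)^{-1}B^T,\quad H_c(X)=Q_c(X)-L_c(X)R_c(X)^{-1}L_c(X)^T,$$ $$\mathscr R(X)=A^TX+XA+Q+\Pi_{11}(X)-[XB+L+\Pi_{12}(X)]\,[R+\Pi_{22}(X)]^{-1}\,[XB+L+\Pi_{12}(X)]^T .$$ The SCARE (stochastic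 continuous-time algebraic Riccati equation) is $\mathscr R(X)=0$. A real square matrix is called stable if all its eigenvalues have negative real part. A tuple $(M_0,M_1,\dots,M_r)$ of $n\times n$ matrices is called stable if the linear differential equation $\dot S=M_0S+SM_0^T+\sum_{i=1}^r M_iSM_i^T$ on the real symmetric $n\times n$ matrices is exponentially stable. A PSD solution $X$ of the SCARE is called stabilizing if $(A+BF,A_0^1+B_0^1F,\dots,A_0^r+B_0^rF)$ is stable for $$F=-[R+\Pi_{22}(X)]^{-1}[B^TX+\Pi_{12}(X)^T+L^T].$$ Write $\widehat Q=Q-LR^{-1}L^T$ and assume: 1. $R\succ0$ and $\begin{bmatrix}Q&L\\L^T&R\end{bmatrix}\succeq0$; 2. (stochastic stabilizability) there is $F\in\mathbb R^{m\times n}$ such that $(A+BF,A_0^1+B_0^1F,\dots,A_0^r+B_0^rF)$ is stable; 3. (stochastic detectability) for some $C\in\mathbb R^{p\times n}$ with $C^TC=\widehat Q$ there is $K\in\mathbb R^{n\times p}$ such that $(\widetilde A+KC,\widetilde A_0^1,\dots,\widetilde A_0^r)$ is stable, where $\widetilde A=A-BR^{-1}L^T$ and $\widetilde A_0^i=A_0^i-B_0^iR^{-1}L^T$;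 4. (kernel condition) $\ker\widehat Q\subseteq\ker L^T\cap\bigcap_{i=1}^r\ker A_0^i$; 5. $(A,B)$ is stabilizable ($A+BF$ is stable for some $F\in\mathbb R^{m\times n}$) and $(\widehat Q,A)$ is detectable ($A+K\widehat Q$ is stable for some $K\in\mathbb R^{n\times n}$). Then the SCARE has exactly one PSD solution $X_*$, and $X_*$ is stabilizing. Consider the iteration FPSDA in exact arithmetic: $X_0=0$, and, with $A_k=A_c(X_k)$, $G_k=G_c(X_k)$, $H_k=H_c(X_k)$, the matrix $X_{k+1}$ is the stabilizing solution of the frozen Riccati equation $$A_k^TX+XA_k-XG_kX+H_k=0,$$ i.e. the solution $X$ for which $A_k-G_kX$ is stable. This iteration defines a unique infinite sequence $(X_k)_{k\ge0}$, and: (i) for all $k\ge0$: $0=X_0\preceq X_1\preceq\dots\preceq X_k\preceq X_*$, $\mathscr R(X_k)\succeq0$, and $A_k-G_kX_*$ is stable; (ii) $\lim_{k\to\infty}X_k=X_*\succeq0$, and every eigenvalue of $A_c(X_*)-G_c(X_*)X_*$ has real part $\le0$. -/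

import Mathlib

open Matrix Filter Topology

namespace StochRiccati

/-- A real square matrix is stable when its (complex) eigenvalues lie in the open left half-plane. -/
def IsStable {n : ℕ} (M : Matrix (Fin n) (Fin n) ℝ) : Prop :=
  ∀ z ∈ spectrum ℂ (M.map (algebraMap ℝ ℂ)), z.re < 0

/-- `(A, B)` is stabilizable: some state feedback `F` makes `A + B F` stable. -/
def IsStabilizable {n m : ℕ} (A : Matrix (Fin n) (Fin n) ℝ) (B : Matrix (Fin n) (Fin m) ℝ) :
    Prop :=
  ∃ F : Matrix (Fin m) (Fin n) ℝ, IsStable (A + B * F)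

/-- `(C, A)` is detectable: some output injection `K` makes `A + K C` stable. -/
def IsDetectable {n p : ℕ} (C : Matrix (Fin p) (Fin n) ℝ) (A : Matrix (Fin n) (Fin n) ℝ) :
    Prop :=
  ∃ K : Matrix (Fin n) (Fin p) ℝ, IsStable (A + K * C)

/-- The generalized Lyapunov operator `S ↦ A S + S Aᵀ + ∑ᵢ Aᵢ S Aᵢᵀ`. -/
def lyapunovOp {n r : ℕ} (A : Matrix (Fin n) (Fin n) ℝ)
    (A₀ : Fin r → Matrix (Fin n) (Fin n) ℝ) (S : Matrix (Fin n) (Fin n) ℝ) :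
    Matrix (Fin n) (Fin n) ℝ :=
  A * S + S * Aᵀ + ∑ i, A₀ i * S * (A₀ i)ᵀ

section ExpStable

open scoped Matrix.Norms.Frobenius

/-- The tuple `(A, A₀ 1, …, A₀ r)` is stable in the stochastic sense: the linear differential
equation `dS/dt = A S + S Aᵀ + ∑ᵢ Aᵢ S Aᵢᵀ` on real symmetric matrices is exponentially stable. -/
def IsExpStable {n r : ℕ} (A : Matrix (Fin n) (Fin n) ℝ)
    (A₀ : Fin r → Matrix (Fin n) (Fin n) ℝ) : Prop :=
  ∃ β > (0 : ℝ), ∃ α > (0 : ℝ), ∀ S : ℝ → Matrix (Fin n) (Fin n) ℝ,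
    (∀ t, (S t).IsSymm) → (∀ t, HasDerivAt S (lyapunovOp A A₀ (S t)) t) →
      ∀ t₀ t, t₀ ≤ t → ‖S t‖ ≤ β * Real.exp (-α * (t - t₀)) * ‖S t₀‖

end ExpStable

/-- `X` is a stabilizing solution of the algebraic Riccati equation
`Aᵀ X + X A - X G X + H = 0`. -/
def IsStabilizingCARESolution {n : ℕ} (A G H X : Matrix (Fin n) (Fin n) ℝ) : Prop :=
  Aᵀ * X + X * A - X * G * X + H = 0 ∧ IsStable (A - G * X)

/-- The coefficient matrices of a stochastic continuous-time algebraic Riccati equation. -/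
structure Coeffs (n m r : ℕ) where
  A : Matrix (Fin n) (Fin n) ℝ
  B : Matrix (Fin n) (Fin m) ℝ
  A₀ : Fin r → Matrix (Fin n) (Fin n) ℝ
  B₀ : Fin r → Matrix (Fin n) (Fin m) ℝ
  Q : Matrix (Fin n) (Fin n) ℝ
  L : Matrix (Fin n) (Fin m) ℝ
  R : Matrix (Fin m) (Fin m) ℝ

namespace Coeffs

variable {n m r : ℕ} (D : Coeffs n m r)

def Pi11 (X : Matrix (Fin n) (Fin n) ℝ) : Matrix (Fin n) (Fin n) ℝ :=
  ∑ i, (D.A₀ i)ᵀ * X * D.A₀ i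

def Pi12 (X : Matrix (Fin n) (Fin n) ℝ) : Matrix (Fin n) (Fin m) ℝ :=
  ∑ i, (D.A₀ i)ᵀ * X * D.B₀ i

def Pi22 (X : Matrix (Fin n) (Fin n) ℝ) : Matrix (Fin m) (Fin m) ℝ :=
  ∑ i, (D.B₀ i)ᵀ * X * D.B₀ i

def Qc (X : Matrix (Fin n) (Fin n) ℝ) : Matrix (Fin n) (Fin n) ℝ := D.Q + D.Pi11 X

def Lc (X : Matrix (Fin n) (Fin n) ℝ) : Matrix (Fin n) (Fin m) ℝ := D.L + D.Pi12 X

def Rc (X : Matrix (Fin n) (Fin n) ℝ) : Matrix (Fin m) (Fin m) ℝ := D.R + D.Pi22 X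

noncomputable def Ac (X : Matrix (Fin n) (Fin n) ℝ) : Matrix (Fin n) (Fin n) ℝ :=
  D.A - D.B * (D.Rc X)⁻¹ * (D.Lc X)ᵀ

noncomputable def Gc (X : Matrix (Fin n) (Fin n) ℝ) : Matrix (Fin n) (Fin n) ℝ :=
  D.B * (D.Rc X)⁻¹ * D.Bᵀ

noncomputable def Hc (X : Matrix (Fin n) (Fin n) ℝ) : Matrix (Fin n) (Fin n) ℝ :=
  D.Qc X - D.Lc X * (D.Rc X)⁻¹ * (D.Lc X)ᵀ

/-- The Riccati function `𝓡(X)`; the stochastic Riccati equation is `𝓡(X) = 0`. -/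
noncomputable def ric (X : Matrix (Fin n) (Fin n) ℝ) : Matrix (Fin n) (Fin n) ℝ :=
  D.Aᵀ * X + X * D.A + D.Q + D.Pi11 X
    - (X * D.B + D.L + D.Pi12 X) * (D.R + D.Pi22 X)⁻¹ * (X * D.B + D.L + D.Pi12 X)ᵀ

/-- The feedback gain
`F_X = -(∑ᵢ Bᵢᵀ X Bᵢ + R)⁻¹ (Bᵀ X + ∑ᵢ Bᵢᵀ X Aᵢ + Lᵀ)`. -/
noncomputable def gain (X : Matrix (Fin n) (Fin n) ℝ) : Matrix (Fin m) (Fin n) ℝ :=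
  -(((∑ i, (D.B₀ i)ᵀ * X * D.B₀ i) + D.R)⁻¹
    * (D.Bᵀ * X + (∑ i, (D.B₀ i)ᵀ * X * D.A₀ i) + D.Lᵀ))

/-- The closed loop with state feedback `F` is exponentially stable. -/
def ClosedLoopStable (F : Matrix (Fin m) (Fin n) ℝ) : Prop :=
  IsExpStable (D.A + D.B * F) (fun i => D.A₀ i + D.B₀ i * F)

/-- The pair `({A₀ⁱ}, {B₀ⁱ})`, `0 ≤ i ≤ r`, is stabilizable. -/
def StochStabilizable : Prop :=
  ∃ F : Matrix (Fin m) (Fin n) ℝ, D.ClosedLoopStable F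

/-- The matrix `Q - L R⁻¹ Lᵀ`. -/
noncomputable def Qhat : Matrix (Fin n) (Fin n) ℝ := D.Q - D.L * D.R⁻¹ * D.Lᵀ

/-- The pair `(C, {A₀ⁱ - B₀ⁱ R⁻¹ Lᵀ})`, `0 ≤ i ≤ r`, is detectable. -/
def StochDetectable {p : ℕ} (C : Matrix (Fin p) (Fin n) ℝ) : Prop :=
  ∃ K : Matrix (Fin n) (Fin p) ℝ,
    IsExpStable (D.A - D.B * D.R⁻¹ * D.Lᵀ + K * C)
      (fun i => D.A₀ i - D.B₀ i * D.R⁻¹ * D.Lᵀ)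

/-- The sequence `X` is generated by the fixed-point iteration: `X (k+1)` is a stabilizing
solution of the Riccati equation whose coefficients are frozen at `X k`. -/
def IsFPSDASeq (X : ℕ → Matrix (Fin n) (Fin n) ℝ) : Prop :=
  ∀ k, IsStabilizingCARESolution (D.Ac (X k)) (D.Gc (X k)) (D.Hc (X k)) (X (k + 1))

end Coeffs

end StochRiccati

/-!
The proof rests on one notion of stability and one comparison principle, applied both to the
stochastic Riccati equation and to the frozen equations, which are Riccati equations without noise
(`Coeffs.frozen`).

*Stability.* A tuple is `LyapStable` if its adjoint Lyapunov operator maps some `P ≻ 0` to a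
negative definite matrix. Separating two convex cones shows that this holds as soon as `S = 0` is the only
`S ⪰ 0` with `lyapunovOp S ⪰ 0` (`lyapStable_of_forall_eq_zero`). This alternative replaces the
Perron–Frobenius eigenvector of the Lyapunov semigroup. It identifies `LyapStable` with exponential
stability, since the semigroup preserves positive semidefiniteness (`IsExpStable.lyapStable`,
`LyapStable.isExpStable`), and, in the absence of noise, with spectral stability
(`lyapStable_of_isStable`, `isStable_of_lyapStable`). For a stable tuple, `adjLyap W ⪰ 0` implies
`W ⪯ 0` (`LyapStable.neg_posSemidef`).

*Riccati equations.* Completing the square writes the Riccati function as the minimum over feedbacks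
`F` of affine Lyapunov functions, attained at the gain (`Coeffs.ricF_eq_ric_add`). Under
detectability the gain of every `X ⪰ 0` with `𝓡(X) ⪯ 0` is stabilizing
(`Coeffs.Regular.feedbackStable_gain`); the comparison principle then puts each `Y ⪰ 0` with
`𝓡(Y) ⪰ 0` below `X` (`Coeffs.Regular.sub_posSemidef`). Hence a positive semidefinite solution is
unique and stabilizing. It exists as the limit of the decreasing Newton–Kleinman iterates
(`Coeffs.Regular.exists_ric_eq_zero`).

*The iteration.* The kernel condition makes every equation frozen at some `Y ⪰ 0` detectable
(`Coeffs.Regular.frozen`), and the frozen Riccati function increases with `Y`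
(`Coeffs.frozen_ric_mono`). Therefore `X k` is a subsolution and `Xs` a supersolution of the
equation frozen at `X k`, whose solution `X (k + 1)` lies between them. The monotone bounded sequence
converges to a positive semidefinite solution, which is `Xs` by uniqueness.
-/

namespace StochRiccati

/-! ### Positive semidefinite real matrices -/

theorem posSemidef_iff_real {n : ℕ} {M : Matrix (Fin n) (Fin n) ℝ} :
    M.PosSemidef ↔ Mᵀ = M ∧ ∀ x, 0 ≤ x ⬝ᵥ (M *ᵥ x) := by
  rw [Matrix.posSemidef_iff_dotProduct_mulVec, Matrix.IsHermitian,
    Matrix.conjTranspose_eq_transpose_of_trivial]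
  simp

theorem posDef_iff_real {n : ℕ} {M : Matrix (Fin n) (Fin n) ℝ} :
    M.PosDef ↔ Mᵀ = M ∧ ∀ x, x ≠ 0 → 0 < x ⬝ᵥ (M *ᵥ x) := by
  rw [Matrix.posDef_iff_dotProduct_mulVec, Matrix.IsHermitian,
    Matrix.conjTranspose_eq_transpose_of_trivial]
  simp

theorem PosSemidef.transpose_eq {n : ℕ} {M : Matrix (Fin n) (Fin n) ℝ} (h : M.PosSemidef) :
    Mᵀ = M := (posSemidef_iff_real.1 h).1

theorem PosDef.transpose_eq {n : ℕ} {M : Matrix (Fin n) (Fin n) ℝ} (h : M.PosDef) :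
    Mᵀ = M := (posDef_iff_real.1 h).1

theorem PosSemidef.quad_nonneg {n : ℕ} {M : Matrix (Fin n) (Fin n) ℝ} (h : M.PosSemidef)
    (x : Fin n → ℝ) : 0 ≤ x ⬝ᵥ (M *ᵥ x) := (posSemidef_iff_real.1 h).2 x

theorem PosDef.quad_pos {n : ℕ} {M : Matrix (Fin n) (Fin n) ℝ} (h : M.PosDef)
    {x : Fin n → ℝ} (hx : x ≠ 0) : 0 < x ⬝ᵥ (M *ᵥ x) := (posDef_iff_real.1 h).2 x hx

/-- Congruence `X ↦ Fᵀ X F` preserves positive semidefiniteness. -/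
theorem PosSemidef.congr {n m : ℕ} {X : Matrix (Fin n) (Fin n) ℝ} (h : X.PosSemidef)
    (F : Matrix (Fin n) (Fin m) ℝ) : (Fᵀ * X * F).PosSemidef := by
  have := h.conjTranspose_mul_mul_same F
  rwa [Matrix.conjTranspose_eq_transpose_of_trivial] at this

theorem PosSemidef.congr' {n m : ℕ} {X : Matrix (Fin n) (Fin n) ℝ} (h : X.PosSemidef)
    (F : Matrix (Fin m) (Fin n) ℝ) : (F * X * Fᵀ).PosSemidef := by
  have := PosSemidef.congr h Fᵀ
  rwa [Matrix.transpose_transpose] at this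

theorem PosSemidef.mulVec_eq_zero {n : ℕ} {M : Matrix (Fin n) (Fin n) ℝ} (h : M.PosSemidef)
    {x : Fin n → ℝ} (hx : x ⬝ᵥ (M *ᵥ x) ≤ 0) : M *ᵥ x = 0 := by
  have := (h.dotProduct_mulVec_zero_iff x).1
    (by simpa using le_antisymm hx (PosSemidef.quad_nonneg h x))
  exact this

theorem PosSemidef.eq_zero_of_neg {n : ℕ} {M : Matrix (Fin n) (Fin n) ℝ} (h : M.PosSemidef)
    (h' : (-M).PosSemidef) : M = 0 := by
  have h1 := h.trace_nonneg
  have h2 := h'.trace_nonneg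
  rw [Matrix.trace_neg] at h2
  exact h.trace_eq_zero_iff.1 (by linarith)

open scoped MatrixOrder in
theorem PosSemidef.exists_factor {n : ℕ} {P : Matrix (Fin n) (Fin n) ℝ} (h : P.PosSemidef) :
    ∃ T : Matrix (Fin n) (Fin n) ℝ, P = Tᵀ * T := by
  obtain ⟨T, hT⟩ := (CStarAlgebra.nonneg_iff_eq_star_mul_self).1
    ((Matrix.nonneg_iff_posSemidef).2 h)
  exact ⟨T, by simpa [star_eq_conjTranspose] using hT⟩

theorem trace_mul_nonneg {n : ℕ} {P S : Matrix (Fin n) (Fin n) ℝ} (hP : P.PosSemidef)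
    (hS : S.PosSemidef) : 0 ≤ (P * S).trace := by
  obtain ⟨T, rfl⟩ := PosSemidef.exists_factor hS
  rw [← Matrix.mul_assoc, Matrix.trace_mul_comm, ← Matrix.mul_assoc]
  exact (PosSemidef.congr' hP T).trace_nonneg

theorem mul_eq_zero_of_trace_mul_le {n : ℕ} {P S : Matrix (Fin n) (Fin n) ℝ} (hP : P.PosSemidef)
    (hS : S.PosSemidef) (h : (P * S).trace ≤ 0) : P * S = 0 := by
  obtain ⟨T, rfl⟩ := PosSemidef.exists_factor hS
  obtain ⟨U, rfl⟩ := PosSemidef.exists_factor hP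
  have h0 : ((U * Tᵀ)ᵀ * (U * Tᵀ)).trace = 0 := by
    apply le_antisymm _ (by
      simpa using (PosSemidef.congr (.one (n := Fin n) (R := ℝ)) (U * Tᵀ)).trace_nonneg)
    refine le_of_eq_of_le ?_ h
    rw [← Matrix.mul_assoc (Uᵀ * U), Matrix.trace_mul_comm _ T]
    simp [Matrix.mul_assoc]
  have h1 : U * Tᵀ = 0 := by
    rw [← Matrix.conjTranspose_eq_transpose_of_trivial] at h0
    exact Matrix.trace_conjTranspose_mul_self_eq_zero_iff.1 h0
  calc Uᵀ * U * (Tᵀ * T) = Uᵀ * (U * Tᵀ) * T := by simp [Matrix.mul_assoc]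
    _ = 0 := by simp [h1]

/-- For `P ≻ 0`, the inequality `Wᵀ P W ⪯ 0` forces `W = 0`. -/
theorem eq_zero_of_congr_eq_zero {n m : ℕ} {P : Matrix (Fin n) (Fin n) ℝ} (hP : P.PosDef)
    {W : Matrix (Fin n) (Fin m) ℝ} (h : (-(Wᵀ * P * W)).PosSemidef) : W = 0 := by
  have h0 := PosSemidef.eq_zero_of_neg (PosSemidef.congr hP.posSemidef W) h
  ext i j
  have h1 : W *ᵥ (Pi.single j 1) = 0 := by
    by_contra hne
    have h2 := PosDef.quad_pos hP hne
    have h3 : (Pi.single j 1) ⬝ᵥ ((Wᵀ * P * W) *ᵥ (Pi.single j (1 : ℝ))) = 0 := by simp [h0]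
    rw [← Matrix.mulVec_mulVec, ← Matrix.mulVec_mulVec, Matrix.dotProduct_mulVec,
      Matrix.vecMul_transpose] at h3
    exact h2.ne' h3
  simpa using congrFun h1 i

theorem quad_congr {n m : ℕ} (F : Matrix (Fin n) (Fin m) ℝ) (X : Matrix (Fin n) (Fin n) ℝ)
    (x : Fin m → ℝ) : x ⬝ᵥ ((Fᵀ * X * F) *ᵥ x) = (F *ᵥ x) ⬝ᵥ (X *ᵥ (F *ᵥ x)) := by
  rw [← Matrix.mulVec_mulVec, ← Matrix.mulVec_mulVec, Matrix.dotProduct_mulVec,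
      Matrix.vecMul_transpose]

theorem quad_eq_trace {n : ℕ} (M : Matrix (Fin n) (Fin n) ℝ) (x : Fin n → ℝ) :
    x ⬝ᵥ (M *ᵥ x) = (M * Matrix.vecMulVec x x).trace := by
  rw [Matrix.mul_vecMulVec, Matrix.trace_vecMulVec, dotProduct_comm]

theorem posSemidef_vecMulVec {n : ℕ} (x : Fin n → ℝ) : (Matrix.vecMulVec x x).PosSemidef := by
  simpa using Matrix.posSemidef_vecMulVec_self_star x

/-- The Rayleigh quotient of `W` relative to `P ≻ 0` attains its maximum `c`; at a maximizer `x`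
the matrix `c P - W ⪰ 0` is singular. -/
theorem exists_max_rayleigh {n : ℕ} [Nonempty (Fin n)] {P W : Matrix (Fin n) (Fin n) ℝ}
    (hP : P.PosDef) (hW : Wᵀ = W) : ∃ (c : ℝ) (x : Fin n → ℝ), x ≠ 0 ∧ (c • P - W).PosSemidef ∧
      (c • P - W) *ᵥ x = 0 := by
  have hcont : ∀ M : Matrix (Fin n) (Fin n) ℝ,
      Continuous fun x : Fin n → ℝ => x ⬝ᵥ (M *ᵥ x) := fun M => by fun_prop
  have hsph : IsCompact (Metric.sphere (0 : Fin n → ℝ) 1) := isCompact_sphere _ _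
  have hne : (Metric.sphere (0 : Fin n → ℝ) 1).Nonempty := NormedSpace.sphere_nonempty.2 zero_le_one
  have hne0 : ∀ x ∈ Metric.sphere (0 : Fin n → ℝ) 1, x ≠ 0 := by
    rintro x hx rfl
    simp at hx
  obtain ⟨x, hx, hmax⟩ := hsph.exists_isMaxOn (f := fun x => (x ⬝ᵥ (W *ᵥ x)) / (x ⬝ᵥ (P *ᵥ x))) hne
    ((hcont W).continuousOn.div (hcont P).continuousOn
      fun x hx => (PosDef.quad_pos hP (hne0 x hx)).ne')
  set c := (x ⬝ᵥ (W *ᵥ x)) / (x ⬝ᵥ (P *ᵥ x)) with hc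
  have hquad : ∀ y, y ⬝ᵥ ((c • P - W) *ᵥ y) = c * (y ⬝ᵥ (P *ᵥ y)) - y ⬝ᵥ (W *ᵥ y) := fun y => by
    simp [Matrix.sub_mulVec, Matrix.smul_mulVec, dotProduct_sub, dotProduct_smul]
  have hpsd : (c • P - W).PosSemidef := by
    rw [posSemidef_iff_real]
    refine ⟨by simp [hW, PosDef.transpose_eq hP], fun y => ?_⟩
    rcases eq_or_ne y 0 with rfl | hy
    · simp
    -- rescale to the unit sphere
    have hy' : ‖y‖ ≠ 0 := by simpa using hy
    have hz : ‖y‖⁻¹ • y ∈ Metric.sphere (0 : Fin n → ℝ) 1 := by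
      simp [norm_smul, hy']
    have h1 : ((‖y‖⁻¹ • y) ⬝ᵥ (W *ᵥ (‖y‖⁻¹ • y))) / ((‖y‖⁻¹ • y) ⬝ᵥ (P *ᵥ (‖y‖⁻¹ • y))) ≤ c :=
      hmax hz
    have hPy := PosDef.quad_pos hP hy
    have h2 : ((‖y‖⁻¹ • y) ⬝ᵥ (W *ᵥ (‖y‖⁻¹ • y))) / ((‖y‖⁻¹ • y) ⬝ᵥ (P *ᵥ (‖y‖⁻¹ • y)))
        = (y ⬝ᵥ (W *ᵥ y)) / (y ⬝ᵥ (P *ᵥ y)) := by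
      simp only [Matrix.mulVec_smul, dotProduct_smul, smul_dotProduct, smul_eq_mul]
      field_simp
    rw [h2, div_le_iff₀ hPy] at h1
    rw [hquad]
    linarith
  refine ⟨c, x, hne0 x hx, hpsd, PosSemidef.mulVec_eq_zero hpsd ?_⟩
  have hPx := PosDef.quad_pos hP (hne0 x hx)
  rw [hquad, hc, div_mul_cancel₀ _ hPx.ne', sub_self]

/-- A positive definite matrix dominates every symmetric matrix after scaling. -/
theorem exists_smul_dominates {n : ℕ} {P W : Matrix (Fin n) (Fin n) ℝ} (hP : P.PosDef)
    (hW : Wᵀ = W) : ∃ c : ℝ, 0 < c ∧ (c • P - W).PosSemidef := by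
  rcases isEmpty_or_nonempty (Fin n) with h | h
  · exact ⟨1, one_pos, by rw [Subsingleton.elim ((1 : ℝ) • P - W) 0]; exact .zero⟩
  obtain ⟨c, x, -, h1, -⟩ := exists_max_rayleigh hP hW
  refine ⟨max c 1, by positivity, ?_⟩
  have h2 : max c 1 • P - W = (c • P - W) + (max c 1 - c) • P := by
    rw [sub_smul]; abel
  rw [h2]
  exact h1.add (hP.posSemidef.smul (sub_nonneg.2 (le_max_left _ _)))

/-- A positive definite matrix is bounded below by a positive multiple of any symmetric matrix. -/
theorem exists_pos_smul_le {n : ℕ} {P W : Matrix (Fin n) (Fin n) ℝ} (hP : P.PosDef)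
    (hW : Wᵀ = W) : ∃ c : ℝ, 0 < c ∧ (P - c • W).PosSemidef := by
  obtain ⟨c, hc, h⟩ := exists_smul_dominates hP hW
  refine ⟨c⁻¹, inv_pos.2 hc, ?_⟩
  have := h.smul (inv_pos.2 hc).le
  rwa [smul_sub, smul_smul, inv_mul_cancel₀ hc.ne', one_smul] at this

theorem mul_eq_zero_of_posSemidef_of_le {n : ℕ} {P P' S : Matrix (Fin n) (Fin n) ℝ}
    (hP : P.PosSemidef) (hPP' : (P' - P).PosSemidef) (hS : S.PosSemidef) (h : P' * S = 0) :
    P * S = 0 := by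
  apply mul_eq_zero_of_trace_mul_le hP hS
  have := trace_mul_nonneg hPP' hS
  rw [Matrix.sub_mul, h, zero_sub, Matrix.trace_neg] at this
  linarith

theorem isClosed_posSemidef {n : ℕ} : IsClosed {M : Matrix (Fin n) (Fin n) ℝ | M.PosSemidef} := by
  simp only [posSemidef_iff_real, Set.ofPred_and, Set.ofPred_forall]
  refine IsClosed.inter (isClosed_eq (by fun_prop) (by fun_prop)) (isClosed_iInter fun x => ?_)
  exact isClosed_le (by fun_prop) (by fun_prop)

/-- Only the symmetric part enters: `W + Wᵀ ≻ 0` is an open condition on `W`. -/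
theorem isOpen_add_transpose_posDef {n : ℕ} :
    IsOpen {W : Matrix (Fin n) (Fin n) ℝ | (W + Wᵀ).PosDef} := by
  have h : {W : Matrix (Fin n) (Fin n) ℝ | (W + Wᵀ).PosDef} =
      {W | ∀ x ∈ Metric.sphere (0 : Fin n → ℝ) 1, 0 < x ⬝ᵥ ((W + Wᵀ) *ᵥ x)} := by
    ext W
    simp only [Set.mem_ofPred_eq, posDef_iff_real]
    constructor
    · rintro ⟨-, h⟩ x hx
      exact h x (by rintro rfl; simp at hx)
    · refine fun h => ⟨by simp [add_comm], fun x hx => ?_⟩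
      have hx' : 0 < ‖x‖ := by simpa using hx
      have h1 := h (‖x‖⁻¹ • x) (by simp [norm_smul, hx'.ne'])
      simp only [Matrix.mulVec_smul, dotProduct_smul, smul_dotProduct, smul_eq_mul] at h1
      have : 0 < ‖x‖⁻¹ := by positivity
      exact pos_of_mul_pos_right (pos_of_mul_pos_right h1 this.le) this.le
  rw [h, isOpen_iff_mem_nhds]
  intro W hW
  have hcomp : IsCompact (Metric.sphere (0 : Fin n → ℝ) 1) := isCompact_sphere _ _
  refine hcomp.eventually_forall_of_forall_eventually (x₀ := W)
    (P := fun W x => 0 < x ⬝ᵥ ((W + Wᵀ) *ᵥ x)) fun x hx => ?_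
  have hc : Continuous fun z : Matrix (Fin n) (Fin n) ℝ × (Fin n → ℝ) =>
      z.2 ⬝ᵥ ((z.1 + z.1ᵀ) *ᵥ z.2) := by fun_prop
  exact (isOpen_lt continuous_const hc).mem_nhds (hW x hx)

/-! ### Lyapunov operators -/

section Lyapunov

/-- The adjoint `X ↦ Aᵀ X + X A + ∑ᵢ Aᵢᵀ X Aᵢ` of `lyapunovOp A A₀` for the trace pairing. -/
def adjLyap {n r : ℕ} (A : Matrix (Fin n) (Fin n) ℝ) (A₀ : Fin r → Matrix (Fin n) (Fin n) ℝ)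
    (X : Matrix (Fin n) (Fin n) ℝ) : Matrix (Fin n) (Fin n) ℝ :=
  Aᵀ * X + X * A + ∑ i, (A₀ i)ᵀ * X * A₀ i

/-- Stability expressed by a Lyapunov inequality: some `P ≻ 0` satisfies `adjLyap A A₀ P ≺ 0`. -/
def LyapStable {n r : ℕ} (A : Matrix (Fin n) (Fin n) ℝ)
    (A₀ : Fin r → Matrix (Fin n) (Fin n) ℝ) : Prop :=
  ∃ P : Matrix (Fin n) (Fin n) ℝ, P.PosDef ∧ (-adjLyap A A₀ P).PosDef

variable {n r : ℕ} (A : Matrix (Fin n) (Fin n) ℝ) (A₀ : Fin r → Matrix (Fin n) (Fin n) ℝ)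

theorem adjLyap_add (X Y : Matrix (Fin n) (Fin n) ℝ) :
    adjLyap A A₀ (X + Y) = adjLyap A A₀ X + adjLyap A A₀ Y := by
  simp only [adjLyap, Matrix.mul_add, Matrix.add_mul, Finset.sum_add_distrib]
  abel

theorem adjLyap_smul (c : ℝ) (X : Matrix (Fin n) (Fin n) ℝ) :
    adjLyap A A₀ (c • X) = c • adjLyap A A₀ X := by
  simp [adjLyap, Finset.smul_sum, smul_add]

theorem adjLyap_neg (X : Matrix (Fin n) (Fin n) ℝ) :
    adjLyap A A₀ (-X) = -adjLyap A A₀ X := by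
  rw [← neg_one_smul ℝ, adjLyap_smul, neg_one_smul]

theorem adjLyap_sub (X Y : Matrix (Fin n) (Fin n) ℝ) :
    adjLyap A A₀ (X - Y) = adjLyap A A₀ X - adjLyap A A₀ Y := by
  rw [sub_eq_add_neg, adjLyap_add, adjLyap_neg, sub_eq_add_neg]

theorem adjLyap_transpose (X : Matrix (Fin n) (Fin n) ℝ) :
    (adjLyap A A₀ X)ᵀ = adjLyap A A₀ Xᵀ := by
  simp only [adjLyap, Matrix.transpose_add, Matrix.transpose_mul, Matrix.transpose_transpose,
    Matrix.transpose_sum, Matrix.mul_assoc]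
  abel

theorem lyapunovOp_add (X Y : Matrix (Fin n) (Fin n) ℝ) :
    lyapunovOp A A₀ (X + Y) = lyapunovOp A A₀ X + lyapunovOp A A₀ Y := by
  simp only [lyapunovOp, Matrix.mul_add, Matrix.add_mul, Finset.sum_add_distrib]
  abel

theorem lyapunovOp_smul (c : ℝ) (X : Matrix (Fin n) (Fin n) ℝ) :
    lyapunovOp A A₀ (c • X) = c • lyapunovOp A A₀ X := by
  simp [lyapunovOp, Finset.smul_sum, smul_add]

theorem lyapunovOp_transpose (X : Matrix (Fin n) (Fin n) ℝ) :
    (lyapunovOp A A₀ X)ᵀ = lyapunovOp A A₀ Xᵀ := by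
  simp only [lyapunovOp, Matrix.transpose_add, Matrix.transpose_mul, Matrix.transpose_transpose,
    Matrix.transpose_sum, Matrix.mul_assoc]
  abel

theorem trace_adjLyap_mul (P S : Matrix (Fin n) (Fin n) ℝ) :
    (adjLyap A A₀ P * S).trace = (P * lyapunovOp A A₀ S).trace := by
  have h1 : (Aᵀ * P * S).trace = (P * (S * Aᵀ)).trace := by
    rw [Matrix.mul_assoc, Matrix.trace_mul_comm, Matrix.mul_assoc]
  have h2 : ∀ i, ((A₀ i)ᵀ * P * A₀ i * S).trace = (P * (A₀ i * S * (A₀ i)ᵀ)).trace := fun i => by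
    rw [Matrix.mul_assoc, Matrix.mul_assoc, Matrix.trace_mul_comm, Matrix.mul_assoc]
  simp only [adjLyap, lyapunovOp, Matrix.add_mul, Matrix.mul_add, Matrix.trace_add,
    Matrix.sum_mul, Matrix.mul_sum, Matrix.trace_sum, h1, h2]
  rw [Matrix.mul_assoc P A S]
  ring

variable {A A₀}

theorem LyapStable.eq_zero_of_lyapunovOp {S : Matrix (Fin n) (Fin n) ℝ} (h : LyapStable A A₀)
    (hS : S.PosSemidef) (hLS : (lyapunovOp A A₀ S).PosSemidef) : S = 0 := by
  obtain ⟨P, hP, hQ⟩ := h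
  have h1 := trace_mul_nonneg hP.posSemidef hLS
  rw [← trace_adjLyap_mul] at h1
  have h2 : -adjLyap A A₀ P * S = 0 := by
    apply mul_eq_zero_of_trace_mul_le hQ.posSemidef hS
    rw [Matrix.neg_mul, Matrix.trace_neg]
    linarith
  exact (hQ.isUnit.mul_right_eq_zero).1 h2

variable (A A₀) in
/-- `adjLyap A A₀` as a linear map. -/
def adjLyapLin : Matrix (Fin n) (Fin n) ℝ →ₗ[ℝ] Matrix (Fin n) (Fin n) ℝ where
  toFun := adjLyap A A₀
  map_add' := adjLyap_add A A₀
  map_smul' := adjLyap_smul A A₀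

/-- A linear functional bounded above on the positive definite cone is nonpositive on the positive
semidefinite cone. -/
theorem nonpos_of_bddAbove_posDef (g : Matrix (Fin n) (Fin n) ℝ →ₗ[ℝ] ℝ) {u : ℝ}
    (hg : ∀ W : Matrix (Fin n) (Fin n) ℝ, W.PosDef → g W ≤ u)
    {W : Matrix (Fin n) (Fin n) ℝ} (hW : W.PosSemidef) : g W ≤ 0 := by
  by_contra hpos
  push Not at hpos
  obtain ⟨k, hk⟩ := exists_nat_gt ((u - g 1) / g W)
  have h3 := hg ((k : ℝ) • W + 1)
    (Matrix.PosDef.posSemidef_add (hW.smul (Nat.cast_nonneg k)) .one)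
  rw [map_add, map_smul, smul_eq_mul] at h3
  rw [div_lt_iff₀ hpos] at hk
  linarith

/-- Every linear functional on matrices agrees on symmetric matrices with the trace pairing against
a symmetric matrix. -/
theorem exists_symm_trace_eq (g : Matrix (Fin n) (Fin n) ℝ →ₗ[ℝ] ℝ) :
    ∃ S : Matrix (Fin n) (Fin n) ℝ, Sᵀ = S ∧
      ∀ W : Matrix (Fin n) (Fin n) ℝ, Wᵀ = W → g W = (S * W).trace := by
  have hg : ∀ W : Matrix (Fin n) (Fin n) ℝ, g W = ∑ i, ∑ j, W i j * g (Matrix.single i j 1) := by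
    intro W
    conv_lhs => rw [Matrix.matrix_eq_sum_single W]
    simp only [map_sum]
    refine Finset.sum_congr rfl fun i _ => Finset.sum_congr rfl fun j _ => ?_
    rw [← smul_eq_mul, ← map_smul, Matrix.smul_single, smul_eq_mul, mul_one]
  refine ⟨Matrix.of fun i j => (g (Matrix.single i j 1) + g (Matrix.single j i 1)) / 2, ?_, ?_⟩
  · ext i j
    simp [add_comm]
  · intro W hW
    have hW' : ∀ i j, W j i = W i j := fun i j => congrFun (congrFun hW i) j
    have h2 : g W = ∑ i, ∑ j, W i j * g (Matrix.single j i 1) := by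
      rw [hg, Finset.sum_comm]
      simp_rw [hW']
    have h3 : g W = (g W + g W) / 2 := by ring
    rw [h3]
    nth_rw 1 [hg W]
    rw [h2, ← Finset.sum_add_distrib, Finset.sum_div]
    simp only [Matrix.trace, Matrix.diag_apply, Matrix.mul_apply, Matrix.of_apply]
    refine Finset.sum_congr rfl fun i _ => ?_
    rw [← Finset.sum_add_distrib, Finset.sum_div]
    refine Finset.sum_congr rfl fun j _ => ?_
    rw [hW' i j]
    ring

/-- Theorem of the alternative: if no nonzero `S ⪰ 0` satisfies `lyapunovOp A A₀ S ⪰ 0`, then the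
Lyapunov inequality is solvable. The separating functional between the open cone of matrices with
negative definite symmetric part and the cone `{adjLyap A A₀ P : P ≻ 0}` is the trace pairing with
an excluded `S`. -/
theorem lyapStable_of_forall_eq_zero
    (h : ∀ S : Matrix (Fin n) (Fin n) ℝ, S.PosSemidef → (lyapunovOp A A₀ S).PosSemidef → S = 0) :
    LyapStable A A₀ := by
  by_contra hcon
  have hconv1 : Convex ℝ {W : Matrix (Fin n) (Fin n) ℝ | (W + Wᵀ).PosDef} := by
    rw [convex_iff_forall_pos]
    intro X hX Y hY a b ha hb _
    have : (a • X + b • Y) + (a • X + b • Y)ᵀ = a • (X + Xᵀ) + b • (Y + Yᵀ) := by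
      simp only [Matrix.transpose_add, Matrix.transpose_smul, smul_add]; abel
    rw [Set.mem_ofPred_eq, this]
    exact (Matrix.PosDef.smul hX ha).add (Matrix.PosDef.smul hY hb)
  have hconv2 : Convex ℝ {W : Matrix (Fin n) (Fin n) ℝ | ∃ P, P.PosDef ∧ W = -adjLyap A A₀ P} := by
    rw [convex_iff_forall_pos]
    rintro _ ⟨P, hP, rfl⟩ _ ⟨P', hP', rfl⟩ a b ha hb _
    refine ⟨a • P + b • P', (Matrix.PosDef.smul hP ha).add (Matrix.PosDef.smul hP' hb), ?_⟩
    rw [adjLyap_add, adjLyap_smul, adjLyap_smul]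
    simp [add_comm]
  have hdisj : Disjoint {W : Matrix (Fin n) (Fin n) ℝ | (W + Wᵀ).PosDef}
      {W : Matrix (Fin n) (Fin n) ℝ | ∃ P, P.PosDef ∧ W = -adjLyap A A₀ P} := by
    rw [Set.disjoint_left]
    rintro W hW ⟨P, hP, rfl⟩
    refine hcon ⟨P, hP, ?_⟩
    have h2 : -adjLyap A A₀ P + (-adjLyap A A₀ P)ᵀ = (2 : ℝ) • (-adjLyap A A₀ P) := by
      rw [Matrix.transpose_neg, adjLyap_transpose, PosDef.transpose_eq hP, two_smul]
    rw [Set.mem_ofPred_eq, h2] at hW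
    simpa [smul_smul] using Matrix.PosDef.smul hW (show (0 : ℝ) < 1 / 2 by norm_num)
  obtain ⟨f, u, hf1, hf2⟩ :=
    geometric_hahn_banach_open hconv1 isOpen_add_transpose_posDef hconv2 hdisj
  have hpd : ∀ W : Matrix (Fin n) (Fin n) ℝ, W.PosDef → (W + Wᵀ).PosDef := fun W hW => by
    rw [PosDef.transpose_eq hW]; exact hW.add hW
  obtain ⟨S, hSt, hS⟩ := exists_symm_trace_eq f.toLinearMap
  have hS' : ∀ W : Matrix (Fin n) (Fin n) ℝ, Wᵀ = W → f W = (S * W).trace := hS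
  have hpd : ∀ W : Matrix (Fin n) (Fin n) ℝ, W.PosDef → (W + Wᵀ).PosDef := fun W hW => by
    rw [PosDef.transpose_eq hW]; exact hW.add hW
  have hg1 : ∀ W : Matrix (Fin n) (Fin n) ℝ, W.PosSemidef → f W ≤ 0 := fun W hW =>
    nonpos_of_bddAbove_posDef f.toLinearMap (fun W hW => (hf1 W (hpd W hW)).le) hW
  have hg2 : ∀ P : Matrix (Fin n) (Fin n) ℝ, P.PosSemidef → f (adjLyap A A₀ P) ≤ 0 := fun P hP =>
    nonpos_of_bddAbove_posDef (f.toLinearMap ∘ₗ adjLyapLin A A₀) (u := -u) (fun P hP => by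
      have := hf2 _ ⟨P, hP, rfl⟩
      rw [map_neg] at this
      change f (adjLyap A A₀ P) ≤ -u
      linarith) hP
  have hadj : ∀ P : Matrix (Fin n) (Fin n) ℝ, P.PosSemidef →
      (adjLyap A A₀ P)ᵀ = adjLyap A A₀ P := fun P hP => by
    rw [adjLyap_transpose, PosSemidef.transpose_eq hP]
  have hzero : -S = 0 := by
    refine h (-S) (posSemidef_iff_real.2 ⟨by rw [Matrix.transpose_neg, hSt], fun x => ?_⟩)
      (posSemidef_iff_real.2 ⟨by rw [lyapunovOp_transpose, Matrix.transpose_neg, hSt], fun x => ?_⟩)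
    · have hx := posSemidef_vecMulVec x
      have := hg1 _ hx
      rw [hS' _ (PosSemidef.transpose_eq hx)] at this
      rw [quad_eq_trace, Matrix.neg_mul, Matrix.trace_neg]
      linarith
    · have hx := posSemidef_vecMulVec x
      have := hg2 _ hx
      rw [hS' _ (hadj _ hx), Matrix.trace_mul_comm, trace_adjLyap_mul] at this
      rw [quad_eq_trace, Matrix.trace_mul_comm, ← trace_adjLyap_mul, Matrix.mul_neg,
        Matrix.trace_neg, trace_adjLyap_mul]
      linarith
  -- then `f` vanishes on symmetric matrices, while it separates `1` from `-adjLyap A A₀ 1`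
  have h1 := hf1 1 (hpd _ .one)
  have h2 := hf2 _ ⟨1, .one, rfl⟩
  rw [map_neg, hS' _ (hadj _ .one), neg_eq_zero.1 hzero] at h2
  rw [hS' _ Matrix.transpose_one, neg_eq_zero.1 hzero] at h1
  simp at h1 h2
  linarith

/-- Comparison principle for Lyapunov inequalities. At a maximizer `x` of the Rayleigh quotient of
`W` relative to `P` the quadratic form of `adjLyap A A₀ (c P - W)` is nonnegative, which forces the
maximum `c` to be nonpositive. -/
theorem LyapStable.neg_posSemidef {W : Matrix (Fin n) (Fin n) ℝ} (h : LyapStable A A₀)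
    (hW : Wᵀ = W) (hLW : (adjLyap A A₀ W).PosSemidef) : (-W).PosSemidef := by
  rcases isEmpty_or_nonempty (Fin n) with hn | hn
  · rw [Subsingleton.elim (-W) 0]; exact .zero
  obtain ⟨P, hP, hQ⟩ := h
  obtain ⟨c, x, hx, hpsd, hker⟩ := exists_max_rayleigh hP hW
  have hc : c ≤ 0 := by
    by_contra hc
    push Not at hc
    set Z := c • P - W with hZ
    have h1 : 0 ≤ x ⬝ᵥ (adjLyap A A₀ Z *ᵥ x) := by
      have e1 : x ⬝ᵥ ((Aᵀ * Z) *ᵥ x) = 0 := by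
        rw [← Matrix.mulVec_mulVec, hker, Matrix.mulVec_zero, dotProduct_zero]
      have e2 : x ⬝ᵥ ((Z * A) *ᵥ x) = 0 := by
        rw [← Matrix.mulVec_mulVec, Matrix.dotProduct_mulVec, ← Matrix.mulVec_transpose,
          PosSemidef.transpose_eq hpsd, hker, zero_dotProduct]
      simp only [adjLyap, Matrix.add_mulVec, dotProduct_add, e1, e2, zero_add,
        Matrix.sum_mulVec, dotProduct_sum]
      exact Finset.sum_nonneg fun i _ => PosSemidef.quad_nonneg (PosSemidef.congr hpsd _) x
    rw [hZ, adjLyap_sub, adjLyap_smul, Matrix.sub_mulVec, Matrix.smul_mulVec, dotProduct_sub,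
      dotProduct_smul, smul_eq_mul] at h1
    have h2 := PosDef.quad_pos hQ hx
    have h3 := PosSemidef.quad_nonneg hLW x
    rw [Matrix.neg_mulVec, dotProduct_neg] at h2
    nlinarith
  have : -W = (c • P - W) + (-c) • P := by rw [neg_smul]; abel
  rw [this]
  exact hpsd.add (hP.posSemidef.smul (neg_nonneg.2 hc))

theorem LyapStable.posSemidef_of_neg {W : Matrix (Fin n) (Fin n) ℝ} (h : LyapStable A A₀)
    (hW : Wᵀ = W) (hLW : (-adjLyap A A₀ W).PosSemidef) : W.PosSemidef := by
  rw [← adjLyap_neg] at hLW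
  simpa using h.neg_posSemidef (by rw [Matrix.transpose_neg, hW]) hLW

/-- The Lyapunov equation with a symmetric right-hand side has a symmetric solution. -/
theorem LyapStable.exists_adjLyap_eq (h : LyapStable A A₀) {W : Matrix (Fin n) (Fin n) ℝ}
    (hW : Wᵀ = W) : ∃ X : Matrix (Fin n) (Fin n) ℝ, Xᵀ = X ∧ adjLyap A A₀ X = W := by
  let V : Submodule ℝ (Matrix (Fin n) (Fin n) ℝ) :=
    { carrier := {X | Xᵀ = X}
      add_mem' := fun {X Y} hX hY => by
        rw [Set.mem_ofPred_eq] at hX hY ⊢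
        rw [Matrix.transpose_add, hX, hY]
      zero_mem' := Matrix.transpose_zero
      smul_mem' := fun c X hX => by
        rw [Set.mem_ofPred_eq] at hX ⊢
        rw [Matrix.transpose_smul, hX] }
  have hmem : ∀ X, X ∈ V ↔ Xᵀ = X := fun X => Iff.rfl
  let T : V →ₗ[ℝ] V := (adjLyapLin A A₀).restrict fun X hX => by
    change (adjLyap A A₀ X)ᵀ = adjLyap A A₀ X
    rw [adjLyap_transpose, (hmem X).1 hX]
  have hT : ∀ X : V, ((T X : V) : Matrix (Fin n) (Fin n) ℝ) = adjLyap A A₀ X := fun X => rfl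
  have hinj : Function.Injective T := by
    rw [injective_iff_map_eq_zero]
    intro X hX
    have h0 : adjLyap A A₀ X = 0 := by rw [← hT, hX]; rfl
    have h1 := h.neg_posSemidef ((hmem _).1 X.2) (by rw [h0]; exact .zero)
    have h2 := h.posSemidef_of_neg ((hmem _).1 X.2) (by rw [h0, neg_zero]; exact .zero)
    exact Subtype.ext (PosSemidef.eq_zero_of_neg h2 h1)
  obtain ⟨X, hX⟩ := LinearMap.injective_iff_surjective.1 hinj ⟨W, hW⟩
  exact ⟨X, X.2, by rw [← hT, hX]⟩

end Lyapunov

/-! ### Spectral stability and the Lyapunov inequality -/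

theorem map_mulVec_re {n : ℕ} (M : Matrix (Fin n) (Fin n) ℝ) (v : Fin n → ℂ) (i : Fin n) :
    ((M.map (algebraMap ℝ ℂ) *ᵥ v) i).re = (M *ᵥ fun j => (v j).re) i := by
  simp [Matrix.mulVec, dotProduct]

theorem map_mulVec_im {n : ℕ} (M : Matrix (Fin n) (Fin n) ℝ) (v : Fin n → ℂ) (i : Fin n) :
    ((M.map (algebraMap ℝ ℂ) *ᵥ v) i).im = (M *ᵥ fun j => (v j).im) i := by
  simp [Matrix.mulVec, dotProduct]

theorem map_mulVec_eq_smul_iff {n : ℕ} (M : Matrix (Fin n) (Fin n) ℝ) (v : Fin n → ℂ) (z : ℂ) :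
    M.map (algebraMap ℝ ℂ) *ᵥ v = z • v ↔
      (M *ᵥ fun j => (v j).re) = z.re • (fun j => (v j).re) - z.im • (fun j => (v j).im) ∧
      (M *ᵥ fun j => (v j).im) = z.re • (fun j => (v j).im) + z.im • (fun j => (v j).re) := by
  simp only [funext_iff, Complex.ext_iff, map_mulVec_re, map_mulVec_im, forall_and]
  simp

theorem mem_spectrum_iff_mulVec {n : ℕ} (M : Matrix (Fin n) (Fin n) ℂ) (z : ℂ) :
    z ∈ spectrum ℂ M ↔ ∃ v, v ≠ 0 ∧ M *ᵥ v = z • v := by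
  rw [← Matrix.spectrum_toLin', ← Module.End.hasEigenvalue_iff_mem_spectrum]
  constructor
  · intro h
    obtain ⟨v, hv⟩ := h.exists_hasEigenvector
    exact ⟨v, hv.2, by simpa using hv.apply_eq_smul⟩
  · rintro ⟨v, hv0, hv⟩
    exact Module.End.hasEigenvalue_of_hasEigenvector
      ⟨Module.End.mem_eigenspace_iff.2 (by simpa using hv), hv0⟩

theorem lyapunovOp_fin_zero {n : ℕ} (M : Matrix (Fin n) (Fin n) ℝ)
    (N : Fin 0 → Matrix (Fin n) (Fin n) ℝ) (S : Matrix (Fin n) (Fin n) ℝ) :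
    lyapunovOp M N S = M * S + S * Mᵀ := by
  simp [lyapunovOp]

theorem adjLyap_fin_zero {n : ℕ} (M : Matrix (Fin n) (Fin n) ℝ)
    (N : Fin 0 → Matrix (Fin n) (Fin n) ℝ) (S : Matrix (Fin n) (Fin n) ℝ) :
    adjLyap M N S = Mᵀ * S + S * M := by
  simp [adjLyap]

/-- For an eigenvector `a + i b` with eigenvalue `z`, the matrix `S = a aᵀ + b bᵀ` satisfies
`M S + S Mᵀ = 2 (re z) S`. -/
theorem isStable_of_lyapStable {n : ℕ} {M : Matrix (Fin n) (Fin n) ℝ}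
    {N : Fin 0 → Matrix (Fin n) (Fin n) ℝ} (h : LyapStable M N) : IsStable M := by
  intro z hz
  obtain ⟨v, hv0, hv⟩ := (mem_spectrum_iff_mulVec _ _).1 hz
  obtain ⟨h1, h2⟩ := (map_mulVec_eq_smul_iff _ _ _).1 hv
  set a : Fin n → ℝ := fun j => (v j).re with ha
  set b : Fin n → ℝ := fun j => (v j).im with hb
  by_contra hre
  push Not at hre
  have hS : (vecMulVec a a + vecMulVec b b).PosSemidef :=
    (posSemidef_vecMulVec a).add (posSemidef_vecMulVec b)
  have hL : lyapunovOp M N (vecMulVec a a + vecMulVec b b) =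
      (2 * z.re) • (vecMulVec a a + vecMulVec b b) := by
    rw [lyapunovOp_fin_zero, Matrix.mul_add, Matrix.add_mul, Matrix.mul_vecMulVec,
      Matrix.mul_vecMulVec, Matrix.vecMulVec_mul, Matrix.vecMulVec_mul, Matrix.vecMul_transpose,
      Matrix.vecMul_transpose, h1, h2]
    ext i j
    simp [vecMulVec_apply]
    ring
  have h0 := h.eq_zero_of_lyapunovOp hS (by rw [hL]; exact hS.smul (by positivity))
  apply hv0
  ext i
  have h3 := congrFun (congrFun h0 i) i
  simp only [Matrix.add_apply, vecMulVec_apply, Matrix.zero_apply] at h3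
  have h4 : (v i).re = 0 := by
    change a i = 0
    nlinarith [mul_self_nonneg (a i), mul_self_nonneg (b i)]
  have h5 : (v i).im = 0 := by
    change b i = 0
    nlinarith [mul_self_nonneg (a i), mul_self_nonneg (b i)]
  exact Complex.ext h4 h5

/-- If the kernel of `S` is contained in the kernel of `T`, then `T` factors through `S`. -/
theorem exists_mul_eq_of_ker_le {n : ℕ} {S T : Matrix (Fin n) (Fin n) ℝ}
    (h : ∀ x, S *ᵥ x = 0 → T *ᵥ x = 0) : ∃ N : Matrix (Fin n) (Fin n) ℝ, T = N * S := by
  have h1 : ∀ i, ∃ c : Fin n → ℝ, ∀ x, (T *ᵥ x) i = ∑ j, c j * (S *ᵥ x) j := by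
    intro i
    have h2 : (LinearMap.proj i ∘ₗ T.mulVecLin) ∈
        Submodule.span ℝ (Set.range fun j => (LinearMap.proj j : (Fin n → ℝ) →ₗ[ℝ] ℝ) ∘ₗ
          S.mulVecLin) := by
      apply mem_span_of_iInf_ker_le_ker
      intro x hx
      simp only [Submodule.mem_iInf, LinearMap.mem_ker, LinearMap.comp_apply, LinearMap.proj_apply,
        Matrix.mulVecLin_apply] at hx ⊢
      exact congrFun (h x (funext hx)) i
    obtain ⟨c, hc⟩ := (Submodule.mem_span_range_iff_exists_fun ℝ).1 h2
    refine ⟨c, fun x => ?_⟩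
    have := LinearMap.congr_fun hc x
    simpa using this.symm
  choose c hc using h1
  refine ⟨Matrix.of c, ?_⟩
  apply Matrix.toLin'.injective
  ext x i
  simp only [LinearMap.comp_apply, Matrix.toLin'_apply, hc, ← Matrix.mulVec_mulVec]
  rfl

/-- If `M S + S Mᵀ ⪰ 0` with `S ⪰ 0`, then the range of `S` is invariant under `M`, and an
eigenvector `S u` of `M` in this range has an eigenvalue with nonnegative real part. -/
theorem lyapStable_of_isStable {n : ℕ} {M : Matrix (Fin n) (Fin n) ℝ}
    (N : Fin 0 → Matrix (Fin n) (Fin n) ℝ) (h : IsStable M) : LyapStable M N := by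
  apply lyapStable_of_forall_eq_zero
  intro S hS hL
  rw [lyapunovOp_fin_zero] at hL
  have hSt := PosSemidef.transpose_eq hS
  have hker : ∀ x, S *ᵥ x = 0 → (S * Mᵀ) *ᵥ x = 0 := by
    intro x hx
    have hx' : (M * S) *ᵥ x = 0 := by rw [← Matrix.mulVec_mulVec, hx, Matrix.mulVec_zero]
    have h1 := PosSemidef.mulVec_eq_zero hL (x := x) (le_of_eq (by
      rw [Matrix.add_mulVec, hx', zero_add, ← Matrix.mulVec_mulVec, Matrix.dotProduct_mulVec,
        ← Matrix.mulVec_transpose, hSt, hx, zero_dotProduct]))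
    rwa [Matrix.add_mulVec, hx', zero_add] at h1
  obtain ⟨K, hK⟩ := exists_mul_eq_of_ker_le hker
  have hMS : M * S = S * Kᵀ := by
    have := congrArg Matrix.transpose hK
    rwa [Matrix.transpose_mul, Matrix.transpose_mul, Matrix.transpose_transpose, hSt] at this
  by_contra hS0
  -- the complexified range of `S`
  set Mc := M.map (algebraMap ℝ ℂ) with hMc
  set Sc := S.map (algebraMap ℝ ℂ) with hSc
  set Kc := (Kᵀ).map (algebraMap ℝ ℂ) with hKc
  have hMSc : Mc * Sc = Sc * Kc := by
    rw [hMc, hSc, hKc, ← Matrix.map_mul, ← Matrix.map_mul, hMS]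
  let V := LinearMap.range Sc.mulVecLin
  have hinv : ∀ w ∈ V, Mc.mulVecLin w ∈ V := by
    rintro _ ⟨u, rfl⟩
    refine ⟨Kc *ᵥ u, ?_⟩
    simp only [Matrix.mulVecLin_apply, Matrix.mulVec_mulVec, hMSc]
  have hnt : Nontrivial V := by
    rw [Submodule.nontrivial_iff_ne_bot]
    intro hbot
    apply hS0
    ext i j
    have h1 : Sc.mulVecLin (Pi.single j 1) = 0 := by
      rw [← Submodule.mem_bot ℂ, ← hbot]
      exact ⟨_, rfl⟩
    have h2 := congrFun h1 i
    simpa [hSc] using h2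
  obtain ⟨z, hz⟩ := Module.End.exists_eigenvalue (Mc.mulVecLin.restrict hinv)
  obtain ⟨⟨w, u, hu⟩, hw⟩ := hz.exists_hasEigenvector
  have hw1 : Mc *ᵥ w = z • w := congrArg Subtype.val hw.apply_eq_smul
  have hw0 : w ≠ 0 := fun h0 => hw.2 (Subtype.ext h0)
  have hre := h z ((mem_spectrum_iff_mulVec _ _).2 ⟨w, hw0, hw1⟩)
  obtain ⟨h1, h2⟩ := (map_mulVec_eq_smul_iff _ _ _).1 hw1
  set a : Fin n → ℝ := fun j => (u j).re with ha
  set b : Fin n → ℝ := fun j => (u j).im with hb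
  have hwa : (fun j => (w j).re) = S *ᵥ a := by
    ext j; rw [← hu]; exact map_mulVec_re S u j
  have hwb : (fun j => (w j).im) = S *ᵥ b := by
    ext j; rw [← hu]; exact map_mulVec_im S u j
  rw [hwa, hwb] at h1 h2
  have hsym : ∀ x, x ⬝ᵥ ((S * Mᵀ) *ᵥ x) = x ⬝ᵥ (M *ᵥ (S *ᵥ x)) := by
    intro x
    rw [Matrix.dotProduct_mulVec, ← Matrix.mulVec_transpose, Matrix.transpose_mul,
      Matrix.transpose_transpose, hSt, dotProduct_comm, Matrix.mulVec_mulVec]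
  have hab : b ⬝ᵥ (S *ᵥ a) = a ⬝ᵥ (S *ᵥ b) := by
    rw [Matrix.dotProduct_mulVec, ← Matrix.mulVec_transpose, hSt, dotProduct_comm]
  have hqa := PosSemidef.quad_nonneg hL a
  have hqb := PosSemidef.quad_nonneg hL b
  rw [Matrix.add_mulVec, dotProduct_add, hsym, ← Matrix.mulVec_mulVec, h1, dotProduct_sub,
    dotProduct_smul, dotProduct_smul, smul_eq_mul, smul_eq_mul] at hqa
  rw [Matrix.add_mulVec, dotProduct_add, hsym, ← Matrix.mulVec_mulVec, h2, dotProduct_add,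
    dotProduct_smul, dotProduct_smul, smul_eq_mul, smul_eq_mul, hab] at hqb
  have ha0 := PosSemidef.quad_nonneg hS a
  have hb0 := PosSemidef.quad_nonneg hS b
  have hsum : 0 ≤ z.re * (a ⬝ᵥ (S *ᵥ a) + b ⬝ᵥ (S *ᵥ b)) := by linarith
  have hle : a ⬝ᵥ (S *ᵥ a) + b ⬝ᵥ (S *ᵥ b) ≤ 0 := by
    by_contra hpos
    push Not at hpos
    linarith [mul_neg_of_neg_of_pos hre hpos]
  have hSa := PosSemidef.mulVec_eq_zero hS (x := a) (by linarith)
  have hSb := PosSemidef.mulVec_eq_zero hS (x := b) (by linarith)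
  apply hw0
  ext j
  exact Complex.ext ((congrFun hwa j).trans (congrFun hSa j))
    ((congrFun hwb j).trans (congrFun hSb j))

/-- The homogeneous Sylvester equation with stable coefficients has only the zero solution: for
`P ≻ 0` with `M P + P Mᵀ ≺ 0`, the matrix `Wᵀ P W` satisfies a Lyapunov inequality for `N`. -/
theorem eq_zero_of_sylvester {n : ℕ} {M N W : Matrix (Fin n) (Fin n) ℝ}
    (hM : IsStable M) (hN : IsStable N) (h : Mᵀ * W + W * N = 0) : W = 0 := by
  obtain ⟨P, hP, hQ⟩ := lyapStable_of_isStable (Fin.elim0 : Fin 0 → _) hM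
  rw [adjLyap_fin_zero] at hQ
  have hNs := lyapStable_of_isStable (Fin.elim0 : Fin 0 → _) hN
  have hPt := PosDef.transpose_eq hP
  have hPi := hP.inv
  have hdet : IsUnit P.det := (Matrix.isUnit_iff_isUnit_det P).1 hP.isUnit
  have hWN : W * N = -(Mᵀ * W) := by rw [← add_eq_zero_iff_eq_neg, add_comm, h]
  have hNW : Nᵀ * Wᵀ = -(Wᵀ * M) := by
    have := congrArg Matrix.transpose hWN
    simpa [Matrix.transpose_mul] using this
  have key : adjLyap N (Fin.elim0 : Fin 0 → _) (Wᵀ * P⁻¹ * W) =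
      (P⁻¹ * W)ᵀ * (-(Mᵀ * P + P * M)) * (P⁻¹ * W) := by
    rw [adjLyap_fin_zero]
    have e1 : Nᵀ * (Wᵀ * P⁻¹ * W) = -(Wᵀ * M * P⁻¹ * W) := by
      rw [← Matrix.mul_assoc, ← Matrix.mul_assoc, hNW]; simp
    have e2 : Wᵀ * P⁻¹ * W * N = -(Wᵀ * P⁻¹ * Mᵀ * W) := by
      rw [Matrix.mul_assoc, hWN]; simp [Matrix.mul_assoc]
    have e3 : (P⁻¹ * W)ᵀ * (Mᵀ * P) * (P⁻¹ * W) = Wᵀ * P⁻¹ * Mᵀ * W := by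
      rw [Matrix.transpose_mul, PosDef.transpose_eq hPi]
      calc Wᵀ * P⁻¹ * (Mᵀ * P) * (P⁻¹ * W) = Wᵀ * P⁻¹ * Mᵀ * (P * P⁻¹) * W := by
            simp only [Matrix.mul_assoc]
        _ = _ := by rw [Matrix.mul_nonsing_inv _ hdet, Matrix.mul_one]
    have e4 : (P⁻¹ * W)ᵀ * (P * M) * (P⁻¹ * W) = Wᵀ * M * P⁻¹ * W := by
      rw [Matrix.transpose_mul, PosDef.transpose_eq hPi]
      calc Wᵀ * P⁻¹ * (P * M) * (P⁻¹ * W) = Wᵀ * (P⁻¹ * P) * M * P⁻¹ * W := by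
            simp only [Matrix.mul_assoc]
        _ = _ := by rw [Matrix.nonsing_inv_mul _ hdet, Matrix.mul_one]
    rw [e1, e2, Matrix.mul_neg, Matrix.neg_mul, Matrix.mul_add, Matrix.add_mul, e3, e4]
    abel
  refine eq_zero_of_congr_eq_zero hPi (hNs.neg_posSemidef ?_ ?_)
  · exact PosSemidef.transpose_eq (PosSemidef.congr hPi.posSemidef W)
  · rw [key]
    exact PosSemidef.congr hQ.posSemidef _

/-- The stabilizing solution of a Riccati equation with symmetric coefficients is unique. The
difference of a solution and the transpose of another one solves a Sylvester equation with stable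
coefficients, so no symmetry of the solutions has to be assumed. -/
theorem IsStabilizingCARESolution.unique {n : ℕ} {A G H X Y : Matrix (Fin n) (Fin n) ℝ}
    (hG : Gᵀ = G) (hH : Hᵀ = H) (hX : IsStabilizingCARESolution A G H X)
    (hY : IsStabilizingCARESolution A G H Y) : X = Y := by
  have main : ∀ {X Y : Matrix (Fin n) (Fin n) ℝ}, IsStabilizingCARESolution A G H X →
      IsStabilizingCARESolution A G H Y → X = Yᵀ := by
    intro X Y hX hY
    have hYt : Aᵀ * Yᵀ + Yᵀ * A - Yᵀ * G * Yᵀ + H = 0 := by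
      have := congrArg Matrix.transpose hY.1
      simp only [Matrix.transpose_add, Matrix.transpose_sub, Matrix.transpose_mul,
        Matrix.transpose_transpose, hG, hH, Matrix.transpose_zero] at this
      rw [← this]
      simp only [Matrix.mul_assoc]
      abel
    have h0 : (A - G * Y)ᵀ * (X - Yᵀ) + (X - Yᵀ) * (A - G * X) = 0 := by
      have : (A - G * Y)ᵀ * (X - Yᵀ) + (X - Yᵀ) * (A - G * X) =
          (Aᵀ * X + X * A - X * G * X + H) - (Aᵀ * Yᵀ + Yᵀ * A - Yᵀ * G * Yᵀ + H) := by
        rw [Matrix.transpose_sub, Matrix.transpose_mul, hG]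
        noncomm_ring
      rw [this, hX.1, hYt, sub_zero]
    exact sub_eq_zero.1 (eq_zero_of_sylvester hY.2 hX.2 h0)
  rw [main hX hY, ← main hY hY]

/-! ### Invariant cones of linear flows -/

section Flow

variable {E : Type*} [NormedAddCommGroup E] [NormedSpace ℝ E]

theorem norm_pow_le_of_norm_le {a : E →L[ℝ] E} {M : ℝ} (hM : 0 ≤ M) (ha : ‖a‖ ≤ M) (k : ℕ) :
    ‖a ^ k‖ ≤ M ^ k := by
  induction k with
  | zero =>
    rw [pow_zero, pow_zero]
    exact ContinuousLinearMap.norm_id_le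
  | succ k ih =>
    rw [pow_succ, pow_succ]
    exact (norm_mul_le _ _).trans (mul_le_mul ih ha (norm_nonneg _) (by positivity))

theorem norm_pow_sub_pow_le {a b : E →L[ℝ] E} {M : ℝ} (hM : 1 ≤ M) (ha : ‖a‖ ≤ M) (hb : ‖b‖ ≤ M)
    (k : ℕ) : ‖a ^ k - b ^ k‖ ≤ k * M ^ k * ‖a - b‖ := by
  induction k with
  | zero => simp
  | succ k ih =>
    have h0 : 0 ≤ M := zero_le_one.trans hM
    have h1 : a ^ (k + 1) - b ^ (k + 1) = (a ^ k - b ^ k) * a + b ^ k * (a - b) := by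
      rw [pow_succ, pow_succ]; noncomm_ring
    have h2 : ‖(a ^ k - b ^ k) * a‖ ≤ (k * M ^ k * ‖a - b‖) * M :=
      (norm_mul_le _ _).trans (mul_le_mul ih ha (norm_nonneg _) (by positivity))
    have h3 : ‖b ^ k * (a - b)‖ ≤ M ^ (k + 1) * ‖a - b‖ :=
      (norm_mul_le _ _).trans (mul_le_mul_of_nonneg_right
        ((norm_pow_le_of_norm_le h0 hb k).trans (pow_le_pow_right₀ hM (Nat.le_succ k)))
        (norm_nonneg _))
    calc ‖a ^ (k + 1) - b ^ (k + 1)‖ ≤ (k * M ^ k * ‖a - b‖) * M + M ^ (k + 1) * ‖a - b‖ := by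
          rw [h1]; exact (norm_add_le _ _).trans (add_le_add h2 h3)
      _ = ((k + 1 : ℕ) : ℝ) * M ^ (k + 1) * ‖a - b‖ := by push_cast; ring

/-- A curve of operators through the identity with derivative `ℓ` grows at most exponentially near
the origin. -/
theorem eventually_norm_le_exp {f : ℝ → E →L[ℝ] E} {ℓ : E →L[ℝ] E} (h0 : f 0 = 1)
    (hf : HasDerivAt f ℓ 0) : ∀ᶠ h in 𝓝[>] (0 : ℝ), ‖f h‖ ≤ Real.exp (h * (‖ℓ‖ + 1)) := by
  have h1 := (hasDerivAt_iff_isLittleO_nhds_zero.1 hf).bound one_pos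
  filter_upwards [h1.filter_mono nhdsWithin_le_nhds, self_mem_nhdsWithin] with h hh hpos
  have hpos' : 0 < h := hpos
  rw [zero_add, h0, one_mul, Real.norm_of_nonneg hpos'.le] at hh
  have h2 : ‖(1 : E →L[ℝ] E)‖ ≤ 1 := ContinuousLinearMap.norm_id_le
  have h3 : f h = (f h - 1 - h • ℓ) + 1 + h • ℓ := by abel
  have h4 : ‖h • ℓ‖ = h * ‖ℓ‖ := by rw [norm_smul, Real.norm_of_nonneg hpos'.le]
  calc ‖f h‖ = ‖(f h - 1 - h • ℓ) + 1 + h • ℓ‖ := by rw [← h3]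
    _ ≤ h + 1 + h * ‖ℓ‖ := by
        rw [← h4]
        exact (norm_add_le _ _).trans
          (add_le_add ((norm_add_le _ _).trans (add_le_add hh h2)) le_rfl)
    _ = h * (‖ℓ‖ + 1) + 1 := by ring
    _ ≤ _ := Real.add_one_le_exp _

/-- Chernoff's product formula in a Banach algebra of operators. -/
theorem tendsto_pow_exp [CompleteSpace E] {f : ℝ → E →L[ℝ] E} {ℓ : E →L[ℝ] E} (h0 : f 0 = 1)
    (hf : HasDerivAt f ℓ 0) {t : ℝ} (ht : 0 < t) :
    Tendsto (fun k : ℕ => f (t / k) ^ k) atTop (𝓝 (NormedSpace.exp (t • ℓ))) := by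
  let _ : NormedAlgebra ℚ (E →L[ℝ] E) := NormedAlgebra.restrictScalars ℚ ℝ _
  set g : ℝ → E →L[ℝ] E := fun s => NormedSpace.exp (s • ℓ) with hg
  have hg0 : g 0 = 1 := by simp [hg]
  have hgd : HasDerivAt g ℓ 0 := by
    have := hasDerivAt_exp_smul_const ℓ (0 : ℝ)
    simpa using this
  have hlim : Tendsto (fun k : ℕ => t / (k : ℝ)) atTop (𝓝[>] 0) := by
    refine tendsto_nhdsWithin_iff.2 ⟨tendsto_const_div_atTop_nhds_zero_nat t, ?_⟩
    filter_upwards [eventually_gt_atTop 0] with k hk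
    have : (0 : ℝ) < k := by exact_mod_cast hk
    exact div_pos ht this
  have hpow : ∀ᶠ k : ℕ in atTop, g (t / k) ^ k = NormedSpace.exp (t • ℓ) := by
    filter_upwards [eventually_gt_atTop 0] with k hk
    have : (k : ℝ) ≠ 0 := by exact_mod_cast hk.ne'
    rw [hg, ← NormedSpace.exp_nsmul, ← Nat.cast_smul_eq_nsmul ℝ, smul_smul, mul_div_cancel₀ _ this]
  have hd : Tendsto (fun s => s⁻¹ • (f s - g s)) (𝓝[>] (0 : ℝ)) (𝓝 0) := by
    have h1 := (hasDerivAt_iff_tendsto_slope_zero.1 (hf.sub hgd)).mono_left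
      (nhdsWithin_mono (0 : ℝ) (show Set.Ioi (0 : ℝ) ⊆ {0}ᶜ from fun s hs => ne_of_gt hs))
    simpa [h0, hg0] using h1
  rw [tendsto_iff_norm_sub_tendsto_zero]
  have hb : Tendsto (fun k : ℕ => t * Real.exp (t * (‖ℓ‖ + 1)) *
      ‖(t / (k : ℝ))⁻¹ • (f (t / k) - g (t / k))‖) atTop (𝓝 0) := by
    have := ((hd.comp hlim).norm).const_mul (t * Real.exp (t * (‖ℓ‖ + 1)))
    simpa using this
  refine squeeze_zero' (Eventually.of_forall fun k => norm_nonneg _) ?_ hb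
  filter_upwards [hlim.eventually (eventually_norm_le_exp h0 hf),
    hlim.eventually (eventually_norm_le_exp hg0 hgd), hpow, eventually_gt_atTop 0]
    with k h1 h2 h3 hk
  have hk0 : (0 : ℝ) < k := by exact_mod_cast hk
  have h4 := norm_pow_sub_pow_le (Real.one_le_exp (by positivity)) h1 h2 k
  rw [h3, ← Real.exp_nat_mul] at h4
  have h5 : (k : ℝ) * (t / k * (‖ℓ‖ + 1)) = t * (‖ℓ‖ + 1) := by field_simp
  rw [h5] at h4
  refine h4.trans (le_of_eq ?_)
  rw [norm_smul, norm_inv, Real.norm_of_nonneg (by positivity : 0 ≤ t / (k : ℝ))]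
  field_simp

/-- A closed set invariant under the steps `x ↦ x + h ℓ x + h² N x`, `h ≥ 0`, is invariant under the
semigroup generated by `ℓ`. -/
theorem exp_mem_of_euler_step [CompleteSpace E] (ℓ N : E →L[ℝ] E) {K : Set E} (hK : IsClosed K)
    (hstep : ∀ h : ℝ, 0 ≤ h → ∀ x ∈ K, x + h • ℓ x + h ^ 2 • N x ∈ K) {t : ℝ} (ht : 0 ≤ t)
    {x : E} (hx : x ∈ K) : NormedSpace.exp (t • ℓ) x ∈ K := by
  rcases ht.eq_or_lt with rfl | ht
  · simpa using hx
  set f : ℝ → E →L[ℝ] E := fun h => 1 + h • ℓ + h ^ 2 • N with hf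
  have hfd : HasDerivAt f ℓ 0 := by
    have h1 : HasDerivAt (fun h : ℝ => h • ℓ) ((1 : ℝ) • ℓ) 0 := (hasDerivAt_id 0).smul_const ℓ
    have h2 : HasDerivAt (fun h : ℝ => h ^ 2 • N) (((2 : ℕ) * (0 : ℝ) ^ (2 - 1) * 1) • N) 0 :=
      ((hasDerivAt_id (0 : ℝ)).pow 2).smul_const N
    have h3 := (h1.const_add 1).add h2
    simp only [one_smul, Nat.cast_ofNat, Nat.add_one_sub_one, pow_one, mul_zero, zero_mul,
      zero_smul, add_zero] at h3
    exact h3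
  have hmem : ∀ h : ℝ, 0 ≤ h → ∀ k : ℕ, (f h ^ k) x ∈ K := by
    intro h hh k
    induction k with
    | zero => simpa using hx
    | succ k ih =>
      rw [pow_succ']
      simpa [hf] using hstep h hh _ ih
  have hlim := tendsto_pow_exp (f := f) (by simp [hf]) hfd ht
  have hlim' : Tendsto (fun k : ℕ => (f (t / k) ^ k) x) atTop (𝓝 (NormedSpace.exp (t • ℓ) x)) :=
    ((ContinuousLinearMap.apply ℝ E x).continuous.tendsto _).comp hlim
  exact hK.mem_of_tendsto hlim' (Eventually.of_forall fun k => hmem _ (by positivity) k)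

end Flow

/-! ### The flow of a linear differential equation on matrices -/

section MatrixFlow

variable {n : ℕ}

/-- A linear operator on matrices, as a continuous operator on the space of arrays with the
supremum norm. -/
noncomputable def toArrayCLM (L : Matrix (Fin n) (Fin n) ℝ →ₗ[ℝ] Matrix (Fin n) (Fin n) ℝ) :
    (Fin n → Fin n → ℝ) →L[ℝ] (Fin n → Fin n → ℝ) :=
  LinearMap.toContinuousLinearMap
    ((Matrix.ofLinearEquiv ℝ).symm.toLinearMap ∘ₗ L ∘ₗ (Matrix.ofLinearEquiv ℝ).toLinearMap)

/-- The solution operator at time `t` of the linear differential equation `Ṡ = L S`. -/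
noncomputable def matrixFlow (L : Matrix (Fin n) (Fin n) ℝ →ₗ[ℝ] Matrix (Fin n) (Fin n) ℝ) (t : ℝ) :
    Matrix (Fin n) (Fin n) ℝ →ₗ[ℝ] Matrix (Fin n) (Fin n) ℝ :=
  (Matrix.ofLinearEquiv ℝ).toLinearMap ∘ₗ
    (NormedSpace.exp (t • toArrayCLM L)).toLinearMap ∘ₗ (Matrix.ofLinearEquiv ℝ).symm.toLinearMap

variable (L : Matrix (Fin n) (Fin n) ℝ →ₗ[ℝ] Matrix (Fin n) (Fin n) ℝ)

theorem matrixFlow_zero (S : Matrix (Fin n) (Fin n) ℝ) : matrixFlow L 0 S = S := by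
  simp [matrixFlow]

theorem hasDerivAt_exp_smul_apply (x : Fin n → Fin n → ℝ) (t : ℝ) :
    HasDerivAt (fun t : ℝ => NormedSpace.exp (t • toArrayCLM L) x)
      (toArrayCLM L (NormedSpace.exp (t • toArrayCLM L) x)) t :=
  (ContinuousLinearMap.apply ℝ (Fin n → Fin n → ℝ) x).hasFDerivAt.comp_hasDerivAt t
    (hasDerivAt_exp_smul_const' (toArrayCLM L) t)

theorem hasDerivAt_matrixFlow (S : Matrix (Fin n) (Fin n) ℝ) (t : ℝ) :
    HasDerivAt (fun t => matrixFlow L t S) (L (matrixFlow L t S)) t :=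
  hasDerivAt_exp_smul_apply L (Matrix.of.symm S) t

theorem matrixFlow_comm (S : Matrix (Fin n) (Fin n) ℝ) (t : ℝ) :
    L (matrixFlow L t S) = matrixFlow L t (L S) := by
  have h : Commute (toArrayCLM L) (NormedSpace.exp (t • toArrayCLM L)) :=
    ((Commute.refl _).smul_right t).exp_right
  exact DFunLike.congr_fun h.eq (Matrix.of.symm S)

theorem eq_matrixFlow_of_hasDerivAt {S : ℝ → Matrix (Fin n) (Fin n) ℝ}
    (hS : ∀ t, HasDerivAt S (L (S t)) t) (t₀ t : ℝ) : S t = matrixFlow L (t - t₀) (S t₀) := by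
  have h1 : ∀ t, HasDerivAt (F := Fin n → Fin n → ℝ) S (toArrayCLM L (S t)) t := hS
  have h2 : ∀ t, HasDerivAt (fun t : ℝ => NormedSpace.exp ((t - t₀) • toArrayCLM L) (S t₀))
      (toArrayCLM L (NormedSpace.exp ((t - t₀) • toArrayCLM L) (S t₀))) t := fun t => by
    have h3 := (hasDerivAt_exp_smul_apply L (S t₀) (t - t₀)).scomp t
      ((hasDerivAt_id t).sub_const t₀)
    rw [one_smul] at h3
    exact h3
  have h3 := ODE_solution_unique_univ (E := Fin n → Fin n → ℝ) (v := fun _ x => toArrayCLM L x)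
    (s := fun _ => Set.univ) (t₀ := t₀) (fun _ => (toArrayCLM L).lipschitz.lipschitzOnWith)
    (fun t => ⟨h1 t, trivial⟩) (fun t => ⟨h2 t, trivial⟩) (by simp; rfl)
  exact congrFun h3 t

theorem matrixFlow_mem_of_euler_step
    (N : Matrix (Fin n) (Fin n) ℝ →ₗ[ℝ] Matrix (Fin n) (Fin n) ℝ)
    {K : Set (Matrix (Fin n) (Fin n) ℝ)} (hK : IsClosed K)
    (hstep : ∀ h : ℝ, 0 ≤ h → ∀ X ∈ K, X + h • L X + h ^ 2 • N X ∈ K) {t : ℝ} (ht : 0 ≤ t)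
    {X : Matrix (Fin n) (Fin n) ℝ} (hX : X ∈ K) : matrixFlow L t X ∈ K :=
  exp_mem_of_euler_step (E := Fin n → Fin n → ℝ) (toArrayCLM L) (toArrayCLM N) (K := K)
    hK hstep ht hX

end MatrixFlow

/-! ### Exponential stability and the Lyapunov inequality -/

section ExpStability

variable {n r : ℕ}

theorem hasDerivAt_linearMap_comp (g : Matrix (Fin n) (Fin n) ℝ →ₗ[ℝ] ℝ)
    {f : ℝ → Matrix (Fin n) (Fin n) ℝ} {f' : Matrix (Fin n) (Fin n) ℝ} {t : ℝ}
    (hf : HasDerivAt f f' t) : HasDerivAt (fun t => g (f t)) (g f') t := by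
  have hf' : HasDerivAt (F := Fin n → Fin n → ℝ) f f' t := hf
  let G : (Fin n → Fin n → ℝ) →L[ℝ] ℝ :=
    LinearMap.toContinuousLinearMap (g ∘ₗ (Matrix.ofLinearEquiv ℝ).toLinearMap)
  exact G.hasFDerivAt.comp_hasDerivAt t hf'

theorem hasDerivAt_transpose {f : ℝ → Matrix (Fin n) (Fin n) ℝ} {f' : Matrix (Fin n) (Fin n) ℝ}
    {t : ℝ} (hf : HasDerivAt f f' t) : HasDerivAt (fun t => (f t)ᵀ) f'ᵀ t := by
  have hf' : HasDerivAt (F := Fin n → Fin n → ℝ) f f' t := hf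
  exact (toArrayCLM (Matrix.transposeLinearEquiv (Fin n) (Fin n) ℝ ℝ).toLinearMap
    ).hasFDerivAt.comp_hasDerivAt t hf'

variable (A : Matrix (Fin n) (Fin n) ℝ) (A₀ : Fin r → Matrix (Fin n) (Fin n) ℝ)

/-- `lyapunovOp A A₀` as a linear map. -/
def lyapunovLin : Matrix (Fin n) (Fin n) ℝ →ₗ[ℝ] Matrix (Fin n) (Fin n) ℝ where
  toFun := lyapunovOp A A₀
  map_add' := lyapunovOp_add A A₀
  map_smul' := lyapunovOp_smul A A₀

/-- The Lyapunov flow preserves positive semidefiniteness, because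
`X + h (A X + X Aᵀ + ∑ᵢ Aᵢ X Aᵢᵀ) + h² A X Aᵀ = (1 + h A) X (1 + h A)ᵀ + h ∑ᵢ Aᵢ X Aᵢᵀ`. -/
theorem matrixFlow_posSemidef {t : ℝ} (ht : 0 ≤ t) {S : Matrix (Fin n) (Fin n) ℝ}
    (hS : S.PosSemidef) : (matrixFlow (lyapunovLin A A₀) t S).PosSemidef := by
  refine matrixFlow_mem_of_euler_step (lyapunovLin A A₀)
    (LinearMap.mulRight ℝ Aᵀ ∘ₗ LinearMap.mulLeft ℝ A) isClosed_posSemidef ?_ ht hS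
  intro h hh X hX
  have key : X + h • lyapunovLin A A₀ X +
      h ^ 2 • (LinearMap.mulRight ℝ Aᵀ ∘ₗ LinearMap.mulLeft ℝ A) X =
      (1 + h • A) * X * (1 + h • A)ᵀ + h • ∑ i, A₀ i * X * (A₀ i)ᵀ := by
    change X + h • lyapunovOp A A₀ X + h ^ 2 • (A * X * Aᵀ) = _
    simp only [lyapunovOp, Matrix.transpose_add, Matrix.transpose_one, Matrix.transpose_smul,
      smul_add, Matrix.add_mul, Matrix.mul_add, Matrix.one_mul, Matrix.mul_one,
      Matrix.smul_mul, Matrix.mul_smul, smul_smul, pow_two]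
    abel
  rw [Set.mem_ofPred_eq, key]
  exact (PosSemidef.congr' hX _).add
    ((Matrix.posSemidef_sum _ fun i _ => PosSemidef.congr' hX _).smul hh)

theorem matrixFlow_transpose {S : Matrix (Fin n) (Fin n) ℝ} (hS : Sᵀ = S) (t : ℝ) :
    (matrixFlow (lyapunovLin A A₀) t S)ᵀ = matrixFlow (lyapunovLin A A₀) t S := by
  have h := eq_matrixFlow_of_hasDerivAt (lyapunovLin A A₀)
    (S := fun t => (matrixFlow (lyapunovLin A A₀) t S)ᵀ) (fun t => by
      have h1 := hasDerivAt_transpose (hasDerivAt_matrixFlow (lyapunovLin A A₀) S t)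
      have h2 : (lyapunovLin A A₀ (matrixFlow (lyapunovLin A A₀) t S))ᵀ =
          lyapunovLin A A₀ (matrixFlow (lyapunovLin A A₀) t S)ᵀ := lyapunovOp_transpose A A₀ _
      rwa [h2] at h1) 0 t
  simpa [matrixFlow_zero, hS] using h

variable {A A₀}

section Norm

open scoped Matrix.Norms.Frobenius

theorem frobenius_norm_sq (S : Matrix (Fin n) (Fin n) ℝ) : ‖S‖ ^ 2 = ∑ i, ∑ j, S i j ^ 2 := by
  rw [Matrix.frobenius_norm_def, ← Real.sqrt_eq_rpow, Real.sq_sqrt]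
  · simp
  · exact Finset.sum_nonneg fun i _ => Finset.sum_nonneg fun j _ => by positivity

theorem abs_quad_le (S : Matrix (Fin n) (Fin n) ℝ) (x : Fin n → ℝ) :
    |x ⬝ᵥ (S *ᵥ x)| ≤ ‖S‖ * (x ⬝ᵥ x) := by
  have hx : 0 ≤ x ⬝ᵥ x := Finset.sum_nonneg fun i _ => mul_self_nonneg _
  apply abs_le_of_sq_le_sq _ (by positivity)
  have h1 : x ⬝ᵥ (S *ᵥ x) = ∑ p : Fin n × Fin n, S p.1 p.2 * (x p.1 * x p.2) := by
    rw [Fintype.sum_prod_type]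
    simp only [dotProduct, Matrix.mulVec, Finset.mul_sum]
    exact Finset.sum_congr rfl fun i _ => Finset.sum_congr rfl fun j _ => by ring
  have h2 : (x ⬝ᵥ x) ^ 2 = ∑ p : Fin n × Fin n, (x p.1 * x p.2) ^ 2 := by
    rw [Fintype.sum_prod_type, pow_two, dotProduct, Finset.sum_mul_sum]
    exact Finset.sum_congr rfl fun i _ => Finset.sum_congr rfl fun j _ => by ring
  have h3 : ‖S‖ ^ 2 = ∑ p : Fin n × Fin n, S p.1 p.2 ^ 2 := by
    rw [frobenius_norm_sq, Fintype.sum_prod_type]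
  rw [mul_pow, h1, h2, h3]
  exact Finset.sum_mul_sq_le_sq_mul_sq _ _ _

theorem norm_smul_one_add_posSemidef {S : Matrix (Fin n) (Fin n) ℝ} (hS : Sᵀ = S) :
    (‖S‖ • (1 : Matrix (Fin n) (Fin n) ℝ) + S).PosSemidef := by
  refine posSemidef_iff_real.2 ⟨by simp [hS], fun x => ?_⟩
  rw [Matrix.add_mulVec, Matrix.smul_mulVec, Matrix.one_mulVec, dotProduct_add, dotProduct_smul,
    smul_eq_mul]
  linarith [neg_abs_le (x ⬝ᵥ (S *ᵥ x)), abs_quad_le S x]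

theorem norm_smul_one_sub_posSemidef {S : Matrix (Fin n) (Fin n) ℝ} (hS : Sᵀ = S) :
    (‖S‖ • (1 : Matrix (Fin n) (Fin n) ℝ) - S).PosSemidef := by
  have := norm_smul_one_add_posSemidef (S := -S) (by rw [Matrix.transpose_neg, hS])
  rwa [norm_neg, ← sub_eq_add_neg] at this

theorem abs_trace_le (S : Matrix (Fin n) (Fin n) ℝ) : |S.trace| ≤ n * ‖S‖ := by
  have h1 : ∀ i, |S i i| ≤ ‖S‖ := fun i => by
    simpa using abs_quad_le S (Pi.single i 1)
  calc |S.trace| ≤ ∑ i, |S i i| := Finset.abs_sum_le_sum_abs _ _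
    _ ≤ ∑ _i : Fin n, ‖S‖ := Finset.sum_le_sum fun i _ => h1 i
    _ = n * ‖S‖ := by simp

theorem PosSemidef.norm_le_trace {Z : Matrix (Fin n) (Fin n) ℝ} (hZ : Z.PosSemidef) :
    ‖Z‖ ≤ Z.trace := by
  obtain ⟨T, hT⟩ := PosSemidef.exists_factor hZ
  have htr : Z.trace = ∑ k, ∑ i, T k i ^ 2 := by
    rw [hT, Matrix.trace, Finset.sum_comm]
    simp [Matrix.mul_apply, pow_two]
  have hle : (Z.trace • (1 : Matrix (Fin n) (Fin n) ℝ) - Z).PosSemidef := by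
    refine posSemidef_iff_real.2 ⟨by simp [PosSemidef.transpose_eq hZ], fun x => ?_⟩
    rw [Matrix.sub_mulVec, Matrix.smul_mulVec, Matrix.one_mulVec, dotProduct_sub, dotProduct_smul,
      smul_eq_mul, sub_nonneg]
    have h1 : x ⬝ᵥ (Z *ᵥ x) = ∑ k, (∑ i, T k i * x i) ^ 2 := by
      have := quad_congr T 1 x
      rw [Matrix.mul_one, ← hT, Matrix.one_mulVec] at this
      rw [this]
      simp [dotProduct, Matrix.mulVec, pow_two]
    rw [h1, htr, Finset.sum_mul]
    refine Finset.sum_le_sum fun k _ => ?_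
    refine (Finset.sum_mul_sq_le_sq_mul_sq _ _ _).trans (le_of_eq ?_)
    simp [dotProduct, pow_two]
  have h2 := trace_mul_nonneg hle hZ
  rw [Matrix.sub_mul, Matrix.smul_mul, Matrix.one_mul, Matrix.trace_sub, Matrix.trace_smul,
    smul_eq_mul] at h2
  have h3 : (Z * Z).trace = ‖Z‖ ^ 2 := by
    rw [frobenius_norm_sq]
    simp only [Matrix.trace, Matrix.diag_apply, Matrix.mul_apply]
    refine Finset.sum_congr rfl fun i _ => Finset.sum_congr rfl fun j _ => ?_
    rw [← congrFun (congrFun (PosSemidef.transpose_eq hZ) i) j, Matrix.transpose_apply, pow_two,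
      congrFun (congrFun (PosSemidef.transpose_eq hZ) j) i |>.symm, Matrix.transpose_apply]
  refine abs_le_of_sq_le_sq' ?_ hZ.trace_nonneg |>.2
  nlinarith

/-- If `S ⪰ 0` and `lyapunovOp A A₀ S ⪰ 0`, then the trace does not decrease along the trajectory
starting at `S`, which decays exponentially; so `S = 0`. -/
theorem IsExpStable.lyapStable (h : IsExpStable A A₀) : LyapStable A A₀ := by
  apply lyapStable_of_forall_eq_zero
  intro S hS hLS
  obtain ⟨β, hβ, α, hα, hdecay⟩ := h
  set L := lyapunovLin A A₀ with hL
  have hSt := PosSemidef.transpose_eq hS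
  have hder : ∀ t, HasDerivAt (fun t => (matrixFlow L t S).trace)
      (matrixFlow L t (L S)).trace t := fun t => by
    have h1 := hasDerivAt_linearMap_comp (Matrix.traceLinearMap (Fin n) ℝ ℝ)
      (hasDerivAt_matrixFlow L S t)
    rwa [matrixFlow_comm] at h1
  have hmono : MonotoneOn (fun t => (matrixFlow L t S).trace) (Set.Ici 0) := by
    refine monotoneOn_of_deriv_nonneg (convex_Ici 0)
      (fun t _ => (hder t).continuousAt.continuousWithinAt)
      (fun t _ => (hder t).differentiableAt.differentiableWithinAt) fun t ht => ?_
    rw [interior_Ici] at ht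
    rw [(hder t).deriv]
    exact (matrixFlow_posSemidef A A₀ (le_of_lt ht) hLS).trace_nonneg
  have hbound : ∀ t : ℝ, 0 ≤ t → S.trace ≤ n * (β * Real.exp (-α * t) * ‖S‖) := by
    intro t ht
    have h1 := hmono Set.self_mem_Ici ht ht
    simp only [matrixFlow_zero] at h1
    have h2 := hdecay (fun t => matrixFlow L t S) (fun t => matrixFlow_transpose A A₀ hSt t)
      (fun t => hasDerivAt_matrixFlow L S t) 0 t ht
    simp only [matrixFlow_zero, sub_zero] at h2
    calc S.trace ≤ (matrixFlow L t S).trace := h1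
      _ ≤ n * ‖matrixFlow L t S‖ := (le_abs_self _).trans (abs_trace_le _)
      _ ≤ _ := by gcongr
  have hlim : Tendsto (fun t : ℝ => n * (β * Real.exp (-α * t) * ‖S‖)) atTop (𝓝 0) := by
    have h1 : Tendsto (fun t : ℝ => -α * t) atTop atBot :=
      tendsto_id.const_mul_atTop_of_neg (by linarith)
    have h2 := ((Real.tendsto_exp_atBot.comp h1).const_mul β).mul_const ‖S‖ |>.const_mul (n : ℝ)
    simpa using h2
  have h0 : S.trace ≤ 0 := ge_of_tendsto hlim (by
    filter_upwards [eventually_ge_atTop 0] with t ht using hbound t ht)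
  exact hS.trace_eq_zero_iff.1 (le_antisymm h0 hS.trace_nonneg)

/-- Along a trajectory in the positive semidefinite cone `tr (P S)` decays exponentially. -/
theorem trace_matrixFlow_le {P Z : Matrix (Fin n) (Fin n) ℝ} {α : ℝ}
    (hα : (-adjLyap A A₀ P - α • P).PosSemidef) (hZ : Z.PosSemidef) {t : ℝ} (ht : 0 ≤ t) :
    (P * matrixFlow (lyapunovLin A A₀) t Z).trace ≤ Real.exp (-α * t) * (P * Z).trace := by
  set L := lyapunovLin A A₀ with hL
  set V : ℝ → ℝ := fun t => (P * matrixFlow L t Z).trace with hV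
  have hder : ∀ t, HasDerivAt V ((adjLyap A A₀ P * matrixFlow L t Z).trace) t := fun t => by
    rw [trace_adjLyap_mul]
    exact hasDerivAt_linearMap_comp
      (Matrix.traceLinearMap (Fin n) ℝ ℝ ∘ₗ LinearMap.mulLeft ℝ P) (hasDerivAt_matrixFlow L Z t)
  have hexp : ∀ t, HasDerivAt (fun t => Real.exp (α * t)) (Real.exp (α * t) * α) t := fun t => by
    have := ((hasDerivAt_id t).const_mul α).exp
    simpa using this
  have hanti : AntitoneOn (fun t => Real.exp (α * t) * V t) (Set.Ici 0) := by
    refine antitoneOn_of_deriv_nonpos (convex_Ici 0)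
      (fun t _ => ((hexp t).mul (hder t)).continuousAt.continuousWithinAt)
      (fun t _ => ((hexp t).mul (hder t)).differentiableAt.differentiableWithinAt) fun t ht => ?_
    rw [interior_Ici] at ht
    have h1 := trace_mul_nonneg hα (matrixFlow_posSemidef A A₀ (le_of_lt ht) hZ)
    rw [Matrix.sub_mul, Matrix.neg_mul, Matrix.smul_mul, Matrix.trace_sub, Matrix.trace_neg,
      Matrix.trace_smul, smul_eq_mul] at h1
    have h2 := ((hexp t).mul (hder t)).deriv
    have h3 : deriv (fun t => Real.exp (α * t) * V t) t =
      Real.exp (α * t) * (α * V t + (adjLyap A A₀ P * matrixFlow L t Z).trace) := by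
      refine h2.trans ?_
      ring
    rw [h3]
    exact mul_nonpos_of_nonneg_of_nonpos (Real.exp_pos _).le (by linarith)
  have h1 := hanti Set.self_mem_Ici ht ht
  simp only [mul_zero, Real.exp_zero, one_mul, hV, matrixFlow_zero] at h1
  rw [neg_mul, Real.exp_neg, ← div_eq_inv_mul, le_div_iff₀ (Real.exp_pos _), mul_comm]
  exact h1

theorem LyapStable.isExpStable (h : LyapStable A A₀) : IsExpStable A A₀ := by
  obtain ⟨P, hP, hQ⟩ := h
  obtain ⟨α, hα, hQα⟩ := exists_pos_smul_le hQ (PosDef.transpose_eq hP)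
  obtain ⟨c, hc, hPc⟩ := exists_pos_smul_le hP (Matrix.transpose_one (n := Fin n) (α := ℝ))
  have hPtr := hP.posSemidef.trace_nonneg
  refine ⟨c⁻¹ * P.trace + 1, by positivity, α, hα, fun S hS hder t₀ t ht => ?_⟩
  set L := lyapunovLin A A₀ with hL
  have hSt : ∀ t, (S t)ᵀ = S t := hS
  have hflow := eq_matrixFlow_of_hasDerivAt L hder t₀ t
  set s := ‖S t₀‖ with hs
  have hτ : 0 ≤ t - t₀ := sub_nonneg.2 ht
  have hbound : ∀ Z : Matrix (Fin n) (Fin n) ℝ, Z.PosSemidef →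
      ‖matrixFlow L (t - t₀) Z‖ ≤ c⁻¹ * (Real.exp (-α * (t - t₀)) * (P * Z).trace) := by
    intro Z hZ
    have hF := matrixFlow_posSemidef A A₀ hτ hZ
    refine (PosSemidef.norm_le_trace hF).trans ?_
    have h1 := trace_mul_nonneg hPc hF
    rw [Matrix.sub_mul, Matrix.smul_mul, Matrix.one_mul, Matrix.trace_sub, Matrix.trace_smul,
      smul_eq_mul] at h1
    rw [← div_eq_inv_mul, le_div_iff₀ hc, mul_comm]
    have h2 := trace_matrixFlow_le hQα hZ hτ
    linarith
  -- `S t₀` is half the difference of the positive semidefinite matrices `s + S t₀`, `s - S t₀`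
  set Zp := s • (1 : Matrix (Fin n) (Fin n) ℝ) + S t₀ with hZp
  set Zm := s • (1 : Matrix (Fin n) (Fin n) ℝ) - S t₀ with hZm
  have hp := hbound Zp (norm_smul_one_add_posSemidef (hSt t₀))
  have hm := hbound Zm (norm_smul_one_sub_posSemidef (hSt t₀))
  have hsplit : S t₀ = (1 / 2 : ℝ) • (Zp - Zm) := by
    have : Zp - Zm = (2 : ℝ) • S t₀ := by rw [hZp, hZm, two_smul]; abel
    rw [this, smul_smul]; norm_num
  have htr : (P * Zp).trace + (P * Zm).trace = 2 * (s * P.trace) := by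
    rw [← Matrix.trace_add, ← Matrix.mul_add]
    have : Zp + Zm = (2 * s) • (1 : Matrix (Fin n) (Fin n) ℝ) := by
      rw [hZp, hZm, mul_smul, two_smul]; abel
    rw [this, Matrix.mul_smul, Matrix.mul_one, Matrix.trace_smul, smul_eq_mul]; ring
  have hnorm : ‖S t‖ ≤ (1 / 2) * (‖matrixFlow L (t - t₀) Zp‖ + ‖matrixFlow L (t - t₀) Zm‖) := by
    rw [hflow, hsplit, map_smul, map_sub, norm_smul]
    have : ‖(1 / 2 : ℝ)‖ = 1 / 2 := by norm_num
    rw [this]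
    exact mul_le_mul_of_nonneg_left (norm_sub_le _ _) (by norm_num)
  set e := Real.exp (-α * (t - t₀)) with he
  have he0 : 0 < e := Real.exp_pos _
  have hs0 : 0 ≤ s := norm_nonneg _
  calc ‖S t‖ ≤ (1 / 2) * (c⁻¹ * (e * (P * Zp).trace) + c⁻¹ * (e * (P * Zm).trace)) :=
        hnorm.trans (mul_le_mul_of_nonneg_left (add_le_add hp hm) (by norm_num))
    _ = (1 / 2) * c⁻¹ * e * ((P * Zp).trace + (P * Zm).trace) := by ring
    _ = (c⁻¹ * P.trace) * e * s := by rw [htr]; ring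
    _ ≤ (c⁻¹ * P.trace + 1) * e * s := by
        gcongr
        linarith

end Norm

end ExpStability

/-! ### Riccati equations with noise -/

/-- A sequence of positive semidefinite matrices that decreases in the Loewner order converges to a
positive semidefinite matrix; the entries converge by polarization. -/
theorem exists_tendsto_of_antitone {n : ℕ} {X : ℕ → Matrix (Fin n) (Fin n) ℝ}
    (hX : ∀ k, (X k).PosSemidef) (hanti : ∀ k, (X k - X (k + 1)).PosSemidef) :
    ∃ Y : Matrix (Fin n) (Fin n) ℝ, Y.PosSemidef ∧ Tendsto X atTop (𝓝 Y) := by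
  have hq : ∀ x : Fin n → ℝ, ∃ l, Tendsto (fun k => x ⬝ᵥ (X k *ᵥ x)) atTop (𝓝 l) := by
    intro x
    refine ⟨_, tendsto_atTop_ciInf (antitone_nat_of_succ_le fun k => ?_) ⟨0, ?_⟩⟩
    · have := PosSemidef.quad_nonneg (hanti k) x
      rw [Matrix.sub_mulVec, dotProduct_sub] at this
      linarith
    · rintro _ ⟨k, rfl⟩
      exact PosSemidef.quad_nonneg (hX k) x
  choose l hl using hq
  have hentry : ∀ k i j, X k i j =
      (((Pi.single i 1 + Pi.single j 1 : Fin n → ℝ) ⬝ᵥ (X k *ᵥ (Pi.single i 1 + Pi.single j 1))) -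
        (Pi.single i 1 : Fin n → ℝ) ⬝ᵥ (X k *ᵥ Pi.single i 1) -
        (Pi.single j 1 : Fin n → ℝ) ⬝ᵥ (X k *ᵥ Pi.single j 1)) / 2 := by
    intro k i j
    have hsym : X k j i = X k i j := congrFun (congrFun (PosSemidef.transpose_eq (hX k)) i) j
    simp only [Matrix.mulVec_add, dotProduct_add, add_dotProduct, Matrix.mulVec_single_one,
      single_one_dotProduct, Matrix.col_apply]
    rw [hsym]; ring
  have hlim : Tendsto X atTop (𝓝 (Matrix.of fun i j => (l (Pi.single i 1 + Pi.single j 1) -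
      l (Pi.single i 1) - l (Pi.single j 1)) / 2)) := by
    refine tendsto_pi_nhds.2 fun i => tendsto_pi_nhds.2 fun j => ?_
    refine Tendsto.congr (fun k => (hentry k i j).symm) ?_
    exact (((hl _).sub (hl _)).sub (hl _)).div_const 2
  exact ⟨_, isClosed_posSemidef.mem_of_tendsto hlim (Eventually.of_forall hX), hlim⟩

theorem continuousAt_matrix_inv {m : ℕ} {M : Matrix (Fin m) (Fin m) ℝ} (h : IsUnit M.det) :
    ContinuousAt (fun M : Matrix (Fin m) (Fin m) ℝ => M⁻¹) M := by
  simp only [Matrix.inv_def, Ring.inverse_eq_inv']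
  have h1 : Continuous fun M : Matrix (Fin m) (Fin m) ℝ => M.det := by fun_prop
  have h2 : Continuous fun M : Matrix (Fin m) (Fin m) ℝ => M.adjugate := by fun_prop
  exact (h1.continuousAt.inv₀ h.ne_zero).smul h2.continuousAt

theorem PosDef.isUnit_det {m : ℕ} {M : Matrix (Fin m) (Fin m) ℝ} (h : M.PosDef) :
    IsUnit M.det := (Matrix.isUnit_iff_isUnit_det M).1 h.isUnit

namespace Coeffs

variable {n m r : ℕ} (D : Coeffs n m r)

/-- The running cost `[1; F]ᵀ [Q L; Lᵀ R] [1; F]` of the feedback `F`. -/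
def cost (F : Matrix (Fin m) (Fin n) ℝ) : Matrix (Fin n) (Fin n) ℝ :=
  D.Q + D.L * F + Fᵀ * D.Lᵀ + Fᵀ * D.R * F

/-- The affine Lyapunov function of the closed loop with the feedback `F`. -/
def ricF (F : Matrix (Fin m) (Fin n) ℝ) (X : Matrix (Fin n) (Fin n) ℝ) :
    Matrix (Fin n) (Fin n) ℝ :=
  adjLyap (D.A + D.B * F) (fun i => D.A₀ i + D.B₀ i * F) X + D.cost F

/-- The feedback `F` is stabilizing, in the sense of the Lyapunov inequality. -/
def FeedbackStable (F : Matrix (Fin m) (Fin n) ℝ) : Prop :=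
  LyapStable (D.A + D.B * F) (fun i => D.A₀ i + D.B₀ i * F)

/-- The hypotheses on the coefficients under which the Riccati equation is solved. Detectability
enters in the weak form that no nonzero `S ⪰ 0` in the kernel of `Q - L R⁻¹ Lᵀ` satisfies the
reversed Lyapunov inequality for the feedback `-R⁻¹ Lᵀ`. -/
structure Regular : Prop where
  posDef : D.R.PosDef
  posSemidef : D.Qhat.PosSemidef
  stabilizable : ∃ F, D.FeedbackStable F
  detectable : ∀ S : Matrix (Fin n) (Fin n) ℝ, S.PosSemidef → D.Qhat * S = 0 →
    (lyapunovOp (D.A - D.B * D.R⁻¹ * D.Lᵀ)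
      (fun i => D.A₀ i - D.B₀ i * D.R⁻¹ * D.Lᵀ) S).PosSemidef → S = 0

variable {D}

theorem transpose_pi12 {X : Matrix (Fin n) (Fin n) ℝ} (hX : Xᵀ = X) :
    (D.Pi12 X)ᵀ = ∑ i, (D.B₀ i)ᵀ * X * D.A₀ i := by
  simp [Pi12, Matrix.transpose_sum, Matrix.transpose_mul, hX, Matrix.mul_assoc]

theorem rc_posDef (hR : D.R.PosDef) {X : Matrix (Fin n) (Fin n) ℝ} (hX : X.PosSemidef) :
    (D.Rc X).PosDef :=
  hR.add_posSemidef (Matrix.posSemidef_sum _ fun _ _ => PosSemidef.congr hX _)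

theorem gain_eq {X : Matrix (Fin n) (Fin n) ℝ} (hX : Xᵀ = X) :
    D.gain X = -((D.Rc X)⁻¹ * (X * D.B + D.L + D.Pi12 X)ᵀ) := by
  rw [gain, Matrix.transpose_add, Matrix.transpose_add, Matrix.transpose_mul, transpose_pi12 hX, hX,
    Rc, Pi22, add_comm D.R]
  congr 2
  abel

/-- The noise terms of the closed loop, expanded in the feedback. -/
theorem sum_noise_eq {X : Matrix (Fin n) (Fin n) ℝ} (hX : Xᵀ = X) (F : Matrix (Fin m) (Fin n) ℝ) :
    ∑ i, (D.A₀ i + D.B₀ i * F)ᵀ * X * (D.A₀ i + D.B₀ i * F) =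
      D.Pi11 X + D.Pi12 X * F + Fᵀ * (D.Pi12 X)ᵀ + Fᵀ * D.Pi22 X * F := by
  rw [transpose_pi12 hX]
  simp only [Pi11, Pi12, Pi22, Matrix.sum_mul, Matrix.mul_sum, ← Finset.sum_add_distrib]
  refine Finset.sum_congr rfl fun i _ => ?_
  simp only [Matrix.transpose_add, Matrix.transpose_mul, Matrix.add_mul, Matrix.mul_add,
    Matrix.mul_assoc]
  abel

theorem ricF_eq {X : Matrix (Fin n) (Fin n) ℝ} (hX : Xᵀ = X) (F : Matrix (Fin m) (Fin n) ℝ) :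
    D.ricF F X = D.Aᵀ * X + X * D.A + D.Q + D.Pi11 X + Fᵀ * D.Rc X * F
      + Fᵀ * (X * D.B + D.L + D.Pi12 X)ᵀ + (X * D.B + D.L + D.Pi12 X) * F := by
  rw [ricF, adjLyap, sum_noise_eq hX, cost, Rc]
  simp only [Matrix.transpose_add, Matrix.transpose_mul, Matrix.add_mul, Matrix.mul_add,
      Matrix.mul_assoc, hX]
  abel

/-- Completion of the square. -/
theorem ricF_eq_ric_add (hR : D.R.PosDef) {X : Matrix (Fin n) (Fin n) ℝ} (hX : X.PosSemidef)
    (F : Matrix (Fin m) (Fin n) ℝ) :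
    D.ricF F X = D.ric X + (F - D.gain X)ᵀ * D.Rc X * (F - D.gain X) := by
  have hXt := PosSemidef.transpose_eq hX
  have hRc := rc_posDef hR hX
  have hdet := PosDef.isUnit_det hRc
  have hRi := PosDef.transpose_eq hRc.inv
  rw [ricF_eq hXt, gain_eq hXt, ric]
  change _ = _ - (X * D.B + D.L + D.Pi12 X) * (D.Rc X)⁻¹ * (X * D.B + D.L + D.Pi12 X)ᵀ + _
  generalize X * D.B + D.L + D.Pi12 X = W
  generalize D.Rc X = M at *
  have h1 : M * M⁻¹ = 1 := Matrix.mul_nonsing_inv _ hdet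
  have h2 : M⁻¹ * M = 1 := Matrix.nonsing_inv_mul _ hdet
  have h3 : (F - -(M⁻¹ * Wᵀ))ᵀ * M * (F - -(M⁻¹ * Wᵀ)) =
      Fᵀ * M * F + Fᵀ * (M * M⁻¹) * Wᵀ + W * (M⁻¹ * M) * F + W * (M⁻¹ * M) * M⁻¹ * Wᵀ := by
    rw [sub_neg_eq_add, Matrix.transpose_add, Matrix.transpose_mul, Matrix.transpose_transpose, hRi]
    simp only [Matrix.add_mul, Matrix.mul_add, Matrix.mul_assoc]
    abel
  rw [h3, h1, h2]
  simp only [Matrix.mul_one]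
  abel

theorem ricF_gain (hR : D.R.PosDef) {X : Matrix (Fin n) (Fin n) ℝ} (hX : X.PosSemidef) :
    D.ricF (D.gain X) X = D.ric X := by
  rw [ricF_eq_ric_add hR hX]
  simp

theorem ric_le_ricF (hR : D.R.PosDef) {X : Matrix (Fin n) (Fin n) ℝ} (hX : X.PosSemidef)
    (F : Matrix (Fin m) (Fin n) ℝ) : (D.ricF F X - D.ric X).PosSemidef := by
  rw [ricF_eq_ric_add hR hX, add_sub_cancel_left]
  exact PosSemidef.congr (rc_posDef hR hX).posSemidef _

theorem cost_eq (hR : D.R.PosDef) (F : Matrix (Fin m) (Fin n) ℝ) :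
    D.cost F = D.Qhat + (F + D.R⁻¹ * D.Lᵀ)ᵀ * D.R * (F + D.R⁻¹ * D.Lᵀ) := by
  have hdet := PosDef.isUnit_det hR
  have hRi := PosDef.transpose_eq hR.inv
  have h1 : D.R * D.R⁻¹ = 1 := Matrix.mul_nonsing_inv _ hdet
  have h2 : D.R⁻¹ * D.R = 1 := Matrix.nonsing_inv_mul _ hdet
  have h3 : (F + D.R⁻¹ * D.Lᵀ)ᵀ * D.R * (F + D.R⁻¹ * D.Lᵀ) =
      Fᵀ * D.R * F + Fᵀ * (D.R * D.R⁻¹) * D.Lᵀ + D.L * (D.R⁻¹ * D.R) * F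
        + D.L * (D.R⁻¹ * D.R) * D.R⁻¹ * D.Lᵀ := by
    rw [Matrix.transpose_add, Matrix.transpose_mul, Matrix.transpose_transpose, hRi]
    simp only [Matrix.add_mul, Matrix.mul_add, Matrix.mul_assoc]
    abel
  rw [h3, h1, h2, cost, Qhat]
  simp only [Matrix.mul_one]
  abel

theorem ricF_sub (F : Matrix (Fin m) (Fin n) ℝ) (X Y : Matrix (Fin n) (Fin n) ℝ) :
    D.ricF F X - D.ricF F Y =
      adjLyap (D.A + D.B * F) (fun i => D.A₀ i + D.B₀ i * F) (X - Y) := by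
  rw [ricF, ricF, adjLyap_sub, add_sub_add_right_eq_sub]

theorem Regular.cost_posSemidef (h : D.Regular) (F : Matrix (Fin m) (Fin n) ℝ) :
    (D.cost F).PosSemidef := by
  rw [cost_eq h.posDef]
  exact h.posSemidef.add (PosSemidef.congr h.posDef.posSemidef _)

/-- The gain of a positive semidefinite supersolution is stabilizing. If `S ⪰ 0` violates the
alternative for the closed loop, pairing the inequality `𝓡(X) ⪯ 0` with `S` shows that the running
cost vanishes on `S`; hence the feedback acts on `S` as `-R⁻¹ Lᵀ`, against detectability. -/
theorem Regular.feedbackStable_gain (h : D.Regular) {X : Matrix (Fin n) (Fin n) ℝ}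
    (hX : X.PosSemidef) (hric : (-D.ric X).PosSemidef) : D.FeedbackStable (D.gain X) := by
  apply lyapStable_of_forall_eq_zero
  intro S hS hLS
  set F := D.gain X with hF
  set E := F + D.R⁻¹ * D.Lᵀ with hE
  have hSt := PosSemidef.transpose_eq hS
  have hER : (Eᵀ * D.R * E).PosSemidef := PosSemidef.congr h.posDef.posSemidef E
  have h1 := trace_mul_nonneg hric hS
  rw [← ricF_gain h.posDef hX, ← hF, ricF, cost_eq h.posDef, ← hE, Matrix.neg_mul, Matrix.trace_neg,
    Matrix.add_mul, Matrix.add_mul, Matrix.trace_add, Matrix.trace_add, trace_adjLyap_mul] at h1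
  have h2 := trace_mul_nonneg hX hLS
  have h3 := trace_mul_nonneg h.posSemidef hS
  have h4 := trace_mul_nonneg hER hS
  have hQS : D.Qhat * S = 0 := mul_eq_zero_of_trace_mul_le h.posSemidef hS (by linarith)
  have hRS : Eᵀ * D.R * E * S = 0 := mul_eq_zero_of_trace_mul_le hER hS (by linarith)
  have hES : E * S = 0 := by
    apply eq_zero_of_congr_eq_zero h.posDef
    have : (E * S)ᵀ * D.R * (E * S) = Sᵀ * (Eᵀ * D.R * E * S) := by
      simp only [Matrix.transpose_mul, Matrix.mul_assoc]
    rw [this, hRS, Matrix.mul_zero, neg_zero]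
    exact .zero
  have hSE : S * Eᵀ = 0 := by
    have := congrArg Matrix.transpose hES
    rwa [Matrix.transpose_mul, hSt, Matrix.transpose_zero] at this
  have hFE : F = E - D.R⁻¹ * D.Lᵀ := by rw [hE, add_sub_cancel_right]
  have hshift : ∀ (M : Matrix (Fin n) (Fin n) ℝ) (N : Matrix (Fin n) (Fin m) ℝ),
      M + N * F = (M - N * D.R⁻¹ * D.Lᵀ) + N * E := fun M N => by
    rw [hFE, Matrix.mul_sub, Matrix.mul_assoc]; abel
  refine h.detectable S hS hQS ?_
  convert hLS using 1
  have hl : ∀ (M : Matrix (Fin n) (Fin n) ℝ) (N : Matrix (Fin n) (Fin m) ℝ),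
      (M + N * F) * S = (M - N * D.R⁻¹ * D.Lᵀ) * S := fun M N => by
    rw [hshift, Matrix.add_mul, Matrix.mul_assoc N E S, hES, Matrix.mul_zero, add_zero]
  have hr : ∀ (M : Matrix (Fin n) (Fin n) ℝ) (N : Matrix (Fin n) (Fin m) ℝ),
      S * (M + N * F)ᵀ = S * (M - N * D.R⁻¹ * D.Lᵀ)ᵀ := fun M N => by
    have := congrArg Matrix.transpose (hl M N)
    rwa [Matrix.transpose_mul, Matrix.transpose_mul, hSt] at this
  simp only [lyapunovOp]
  rw [hl, hr]
  congr 1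
  refine Finset.sum_congr rfl fun i _ => ?_
  rw [hl, Matrix.mul_assoc _ S, Matrix.mul_assoc _ S, hr]

/-- Positive semidefinite subsolutions lie below a supersolution with stabilizing gain. -/
theorem sub_posSemidef_of_ric (hR : D.R.PosDef) {X Y : Matrix (Fin n) (Fin n) ℝ}
    (hX : X.PosSemidef) (hY : Y.PosSemidef) (hricX : (-D.ric X).PosSemidef)
    (hricY : (D.ric Y).PosSemidef) (hF : D.FeedbackStable (D.gain X)) : (X - Y).PosSemidef := by
  refine hF.posSemidef_of_neg (by
    rw [Matrix.transpose_sub, PosSemidef.transpose_eq hX, PosSemidef.transpose_eq hY]) ?_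
  rw [← ricF_sub, ricF_gain hR hX]
  have h1 := (hricX.add hricY).add (ric_le_ricF hR hY (D.gain X))
  convert h1 using 1
  abel

theorem Regular.sub_posSemidef (h : D.Regular) {X Y : Matrix (Fin n) (Fin n) ℝ}
    (hX : X.PosSemidef) (hY : Y.PosSemidef) (hricX : (-D.ric X).PosSemidef)
    (hricY : (D.ric Y).PosSemidef) : (X - Y).PosSemidef :=
  sub_posSemidef_of_ric h.posDef hX hY hricX hricY (h.feedbackStable_gain hX hricX)

theorem Regular.eq_of_ric_eq_zero (h : D.Regular) {X Y : Matrix (Fin n) (Fin n) ℝ}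
    (hX : X.PosSemidef) (hY : Y.PosSemidef) (hricX : D.ric X = 0) (hricY : D.ric Y = 0) :
    X = Y := by
  have h0 : (0 : Matrix (Fin n) (Fin n) ℝ).PosSemidef := .zero
  have h0' : (-0 : Matrix (Fin n) (Fin n) ℝ).PosSemidef := by rw [neg_zero]; exact h0
  have h1 := h.sub_posSemidef hX hY (by rwa [hricX]) (by rwa [hricY])
  have h2 := h.sub_posSemidef hY hX (by rwa [hricY]) (by rwa [hricX])
  rw [← neg_sub] at h2
  exact sub_eq_zero.1 (PosSemidef.eq_zero_of_neg h1 h2)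

/-- A supersolution is obtained by scaling a Lyapunov matrix of a stabilizing feedback. -/
theorem Regular.exists_supersolution (h : D.Regular) :
    ∃ X : Matrix (Fin n) (Fin n) ℝ, X.PosSemidef ∧ (-D.ric X).PosSemidef := by
  obtain ⟨F, P, hP, hQ⟩ := h.stabilizable
  obtain ⟨c, hc, hdom⟩ := exists_smul_dominates hQ (PosSemidef.transpose_eq (h.cost_posSemidef F))
  have hcP : (c • P).PosSemidef := hP.posSemidef.smul hc.le
  refine ⟨c • P, hcP, ?_⟩
  have h1 := hdom.add (ric_le_ricF h.posDef hcP F)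
  convert h1 using 1
  rw [ricF, adjLyap_smul, smul_neg]
  abel

/-- One step of the Newton–Kleinman iteration, starting from a supersolution. -/
theorem Regular.exists_newton_step (h : D.Regular) {X : Matrix (Fin n) (Fin n) ℝ}
    (hX : X.PosSemidef) (hric : (-D.ric X).PosSemidef) :
    ∃ Y : Matrix (Fin n) (Fin n) ℝ, Y.PosSemidef ∧ (-D.ric Y).PosSemidef ∧
      (X - Y).PosSemidef ∧ D.ricF (D.gain X) Y = 0 := by
  have hF := h.feedbackStable_gain hX hric
  have hcost := h.cost_posSemidef (D.gain X)
  obtain ⟨Y, hYt, hY⟩ := hF.exists_adjLyap_eq (W := -D.cost (D.gain X))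
    (by rw [Matrix.transpose_neg, PosSemidef.transpose_eq hcost])
  have hric0 : D.ricF (D.gain X) Y = 0 := by rw [ricF, hY, neg_add_cancel]
  have hYpsd : Y.PosSemidef := hF.posSemidef_of_neg hYt (by rwa [hY, neg_neg])
  refine ⟨Y, hYpsd, ?_, ?_, hric0⟩
  · have := ric_le_ricF h.posDef hYpsd (D.gain X)
    rwa [hric0, zero_sub] at this
  · refine hF.posSemidef_of_neg
      (by rw [Matrix.transpose_sub, PosSemidef.transpose_eq hX, hYt]) ?_
    rwa [← ricF_sub, hric0, sub_zero, ricF_gain h.posDef hX]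

theorem continuousAt_rc_inv (hR : D.R.PosDef) {X : Matrix (Fin n) (Fin n) ℝ} (hX : X.PosSemidef) :
    ContinuousAt (fun X => (D.Rc X)⁻¹) X := by
  have h1 : Continuous fun X => D.Rc X := by
    unfold Rc Pi22
    fun_prop
  exact (continuousAt_matrix_inv (PosDef.isUnit_det (rc_posDef hR hX))).comp h1.continuousAt

theorem continuousAt_gain (hR : D.R.PosDef) {X : Matrix (Fin n) (Fin n) ℝ} (hX : X.PosSemidef) :
    ContinuousAt D.gain X := by
  have h1 : D.gain = fun X => -((D.Rc X)⁻¹ *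
      (D.Bᵀ * X + (∑ i, (D.B₀ i)ᵀ * X * D.A₀ i) + D.Lᵀ)) := by
    funext X
    rw [gain, Rc, Pi22, add_comm D.R]
  have h2 : Continuous fun X : Matrix (Fin n) (Fin n) ℝ => D.Bᵀ * X +
      (∑ i, (D.B₀ i)ᵀ * X * D.A₀ i) + D.Lᵀ := by fun_prop
  have h3 : Continuous fun p : Matrix (Fin m) (Fin m) ℝ × Matrix (Fin m) (Fin n) ℝ =>
      -(p.1 * p.2) := by fun_prop
  rw [h1]
  exact ContinuousAt.comp (f := fun X => ((D.Rc X)⁻¹, _)) h3.continuousAt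
    ((continuousAt_rc_inv hR hX).prodMk h2.continuousAt)

theorem continuous_ricF :
    Continuous fun p : Matrix (Fin m) (Fin n) ℝ × Matrix (Fin n) (Fin n) ℝ => D.ricF p.1 p.2 := by
  unfold ricF adjLyap cost
  fun_prop

/-- Existence of a positive semidefinite solution, as the limit of the decreasing Newton–Kleinman
iteration. -/
theorem Regular.exists_ric_eq_zero (h : D.Regular) :
    ∃ X : Matrix (Fin n) (Fin n) ℝ, X.PosSemidef ∧ D.ric X = 0 := by
  let T := {X : Matrix (Fin n) (Fin n) ℝ // X.PosSemidef ∧ (-D.ric X).PosSemidef}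
  have hstep : ∀ X : T, ∃ Y : T, (X.1 - Y.1).PosSemidef ∧ D.ricF (D.gain X.1) Y.1 = 0 := by
    rintro ⟨X, hX, hric⟩
    obtain ⟨Y, hY1, hY2, hY3, hY4⟩ := h.exists_newton_step hX hric
    exact ⟨⟨Y, hY1, hY2⟩, hY3, hY4⟩
  choose φ hφ1 hφ2 using hstep
  obtain ⟨X₀, hX₀⟩ := h.exists_supersolution
  let X : ℕ → T := fun k => φ^[k] ⟨X₀, hX₀⟩
  have hsucc : ∀ k, X (k + 1) = φ (X k) := fun k => Function.iterate_succ_apply' φ k _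
  obtain ⟨Y, hY, hlim⟩ := exists_tendsto_of_antitone (X := fun k => (X k).1)
    (fun k => (X k).2.1) (fun k => by rw [hsucc]; exact hφ1 _)
  refine ⟨Y, hY, ?_⟩
  have h1 : Tendsto (fun k => D.gain (X k).1) atTop (𝓝 (D.gain Y)) :=
    (continuousAt_gain h.posDef hY).tendsto.comp hlim
  have h2 := (continuous_ricF (D := D)).continuousAt.tendsto.comp
    (h1.prodMk_nhds (hlim.comp (tendsto_add_atTop_nat 1)))
  rw [← ricF_gain h.posDef hY]
  refine tendsto_nhds_unique h2 (tendsto_const_nhds.congr fun k => ?_)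
  simp only [Function.comp_apply, hsucc, hφ2]

/-! ### Frozen Riccati equations -/

variable (D) in
/-- The noise-free Riccati equation obtained by freezing the noise terms at `Y`. -/
def frozen (Y : Matrix (Fin n) (Fin n) ℝ) : Coeffs n m 0 where
  A := D.A
  B := D.B
  A₀ := Fin.elim0
  B₀ := Fin.elim0
  Q := D.Qc Y
  L := D.Lc Y
  R := D.Rc Y

theorem frozen_ric (X Y : Matrix (Fin n) (Fin n) ℝ) :
    (D.frozen Y).ric X = D.Aᵀ * X + X * D.A + D.Qc Y
      - (X * D.B + D.Lc Y) * (D.Rc Y)⁻¹ * (X * D.B + D.Lc Y)ᵀ := by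
  simp [ric, frozen, Pi11, Pi12, Pi22]

theorem frozen_ric_self (X : Matrix (Fin n) (Fin n) ℝ) : (D.frozen X).ric X = D.ric X := by
  rw [frozen_ric, ric, Qc, Lc, Rc, ← add_assoc, ← add_assoc]

theorem frozen_ric_eq (hR : D.R.PosDef) {X Y : Matrix (Fin n) (Fin n) ℝ} (hX : Xᵀ = X)
    (hY : Y.PosSemidef) : (D.frozen Y).ric X =
      (D.Ac Y)ᵀ * X + X * D.Ac Y - X * D.Gc Y * X + D.Hc Y := by
  rw [frozen_ric, Ac, Gc, Hc]
  simp only [Matrix.transpose_add, Matrix.transpose_sub, Matrix.transpose_mul,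
    Matrix.transpose_transpose, hX, PosDef.transpose_eq (rc_posDef hR hY).inv, Matrix.mul_add,
    Matrix.add_mul, Matrix.mul_sub, Matrix.sub_mul, Matrix.mul_assoc]
  abel

theorem frozen_closedLoop (X Y : Matrix (Fin n) (Fin n) ℝ) :
    D.A + D.B * (D.frozen Y).gain X = D.Ac Y - D.Gc Y * X := by
  have h : (D.frozen Y).gain X = -((D.Rc Y)⁻¹ * (D.Bᵀ * X + (D.Lc Y)ᵀ)) := by
    simp [gain, frozen]
  rw [h, Ac, Gc]
  simp only [Matrix.mul_neg, Matrix.mul_add, Matrix.mul_assoc]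
  abel

theorem frozen_cost {Y : Matrix (Fin n) (Fin n) ℝ} (hY : Yᵀ = Y) (F : Matrix (Fin m) (Fin n) ℝ) :
    (D.frozen Y).cost F =
      D.cost F + ∑ i, (D.A₀ i + D.B₀ i * F)ᵀ * Y * (D.A₀ i + D.B₀ i * F) := by
  rw [sum_noise_eq hY]
  simp only [cost, frozen, Qc, Lc, Rc, Matrix.transpose_add, Matrix.add_mul, Matrix.mul_add]
  abel

/-- The frozen Riccati function is monotone in the matrix at which the noise is frozen, being the
minimum over the feedbacks of functions with this property. -/
theorem frozen_ric_mono (hR : D.R.PosDef) {X Y Z : Matrix (Fin n) (Fin n) ℝ} (hX : X.PosSemidef)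
    (hY : Y.PosSemidef) (hZ : Z.PosSemidef) (hYZ : (Z - Y).PosSemidef) :
    ((D.frozen Z).ric X - (D.frozen Y).ric X).PosSemidef := by
  set F := (D.frozen Z).gain X with hF
  have h1 := ricF_gain (D := D.frozen Z) (rc_posDef hR hZ) hX
  have h2 := ric_le_ricF (D := D.frozen Y) (rc_posDef hR hY) hX F
  have h3 : (∑ i, (D.A₀ i + D.B₀ i * F)ᵀ * (Z - Y) * (D.A₀ i + D.B₀ i * F)).PosSemidef :=
    Matrix.posSemidef_sum _ fun i _ => PosSemidef.congr hYZ _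
  have h4 : (D.frozen Z).ricF F X - (D.frozen Y).ricF F X =
      ∑ i, (D.A₀ i + D.B₀ i * F)ᵀ * (Z - Y) * (D.A₀ i + D.B₀ i * F) := by
    rw [ricF, ricF, frozen_cost (PosSemidef.transpose_eq hZ),
      frozen_cost (PosSemidef.transpose_eq hY)]
    simp only [Matrix.mul_sub, Matrix.sub_mul, Finset.sum_sub_distrib]
    change adjLyap (D.A + D.B * F) _ X + _ - (adjLyap (D.A + D.B * F) _ X + _) = _
    rw [adjLyap_fin_zero, adjLyap_fin_zero]
    abel
  rw [← h1, ← hF]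
  have h5 := h3.add h2
  rw [← h4] at h5
  convert h5 using 1
  abel

theorem ric_zero : D.ric 0 = D.Qhat := by
  simp [ric, Qhat, Pi11, Pi12, Pi22]

theorem frozen_qhat (Y : Matrix (Fin n) (Fin n) ℝ) : (D.frozen Y).Qhat = D.Hc Y := rfl

theorem hc_sub_qhat_posSemidef (hR : D.R.PosDef) {Y : Matrix (Fin n) (Fin n) ℝ}
    (hY : Y.PosSemidef) : (D.Hc Y - D.Qhat).PosSemidef := by
  have := frozen_ric_mono hR .zero .zero hY (by rwa [sub_zero])
  rwa [frozen_ric_self, ric_zero, ric_zero, frozen_qhat] at this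

theorem lyapunovOp_add_of_mul_eq_zero {A N S : Matrix (Fin n) (Fin n) ℝ}
    (A₀ : Fin r → Matrix (Fin n) (Fin n) ℝ) (hS : Sᵀ = S) (hN : N * S = 0) :
    lyapunovOp (A + N) A₀ S = lyapunovOp A A₀ S := by
  have h : S * Nᵀ = 0 := by
    have := congrArg Matrix.transpose hN
    rwa [Matrix.transpose_mul, hS, Matrix.transpose_zero] at this
  rw [lyapunovOp, lyapunovOp, Matrix.add_mul, hN, Matrix.transpose_add, Matrix.mul_add, h, add_zero,
    add_zero]

theorem mul_eq_zero_of_ker_le {k : ℕ} {M S : Matrix (Fin n) (Fin n) ℝ}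
    {N : Matrix (Fin k) (Fin n) ℝ} (h : ∀ v : Fin n → ℝ, M *ᵥ v = 0 → N *ᵥ v = 0)
    (hMS : M * S = 0) : N * S = 0 := by
  apply Matrix.toLin'.injective
  ext1 x
  ext1
  have := h (S *ᵥ Pi.single x 1) (by rw [Matrix.mulVec_mulVec, hMS, Matrix.zero_mulVec])
  rw [Matrix.mulVec_mulVec] at this
  rw [LinearMap.comp_apply, Matrix.toLin'_apply, map_zero, LinearMap.zero_comp,
    LinearMap.zero_apply]
  simpa using this

theorem regular_of_stochDetectable {p : ℕ} {C : Matrix (Fin p) (Fin n) ℝ} (hR : D.R.PosDef)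
    (hstab : D.StochStabilizable) (hC : Cᵀ * C = D.Qhat) (hdet : D.StochDetectable C) :
    D.Regular where
  posDef := hR
  posSemidef := by
    rw [← hC]
    simpa using PosSemidef.congr (.one (n := Fin p) (R := ℝ)) C
  stabilizable := by
    obtain ⟨F, hF⟩ := hstab
    exact ⟨F, IsExpStable.lyapStable hF⟩
  detectable S hS hQS hLS := by
    obtain ⟨K, hK⟩ := hdet
    have hCS : C * S = 0 := by
      apply eq_zero_of_congr_eq_zero (.one (n := Fin p) (R := ℝ))
      rw [Matrix.mul_one, Matrix.transpose_mul, Matrix.mul_assoc, ← Matrix.mul_assoc Cᵀ, hC, hQS,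
        Matrix.mul_zero, neg_zero]
      exact .zero
    refine hK.lyapStable.eq_zero_of_lyapunovOp hS ?_
    rwa [lyapunovOp_add_of_mul_eq_zero _ (PosSemidef.transpose_eq hS)
      (by rw [Matrix.mul_assoc, hCS, Matrix.mul_zero])]

/-- Under the kernel condition, on the range of a matrix `S` with `Hc Y * S = 0` the coefficient
`Ac Y` acts as `A`, so that detectability of `(Q - L R⁻¹ Lᵀ, A)` passes to the frozen equations. -/
theorem Regular.frozen (h : D.Regular)
    (hker : ∀ v : Fin n → ℝ, D.Qhat *ᵥ v = 0 → D.Lᵀ *ᵥ v = 0 ∧ ∀ i, D.A₀ i *ᵥ v = 0)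
    (hAB : IsStabilizable D.A D.B) (hQA : IsDetectable D.Qhat D.A)
    {Y : Matrix (Fin n) (Fin n) ℝ} (hY : Y.PosSemidef) : (D.frozen Y).Regular where
  posDef := rc_posDef h.posDef hY
  posSemidef := by
    rw [frozen_qhat]
    simpa using (hc_sub_qhat_posSemidef h.posDef hY).add h.posSemidef
  stabilizable := by
    obtain ⟨F, hF⟩ := hAB
    exact ⟨F, lyapStable_of_isStable _ hF⟩
  detectable S hS hQS hLS := by
    have hSt := PosSemidef.transpose_eq hS
    have hQS' : D.Qhat * S = 0 :=
      mul_eq_zero_of_posSemidef_of_le h.posSemidef (hc_sub_qhat_posSemidef h.posDef hY) hS hQS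
    have hLS' : D.Lᵀ * S = 0 := mul_eq_zero_of_ker_le (fun v hv => (hker v hv).1) hQS'
    have hAS : ∀ i, D.A₀ i * S = 0 := fun i =>
      mul_eq_zero_of_ker_le (fun v hv => (hker v hv).2 i) hQS'
    have hLc : (D.Lc Y)ᵀ * S = 0 := by
      rw [Lc, Matrix.transpose_add, transpose_pi12 (PosSemidef.transpose_eq hY), Matrix.add_mul,
        hLS', zero_add, Matrix.sum_mul]
      refine Finset.sum_eq_zero fun i _ => ?_
      rw [Matrix.mul_assoc, hAS, Matrix.mul_zero]
    obtain ⟨K, hK⟩ := hQA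
    refine (lyapStable_of_isStable (Fin.elim0 : Fin 0 → _) hK).eq_zero_of_lyapunovOp hS ?_
    rw [lyapunovOp_add_of_mul_eq_zero _ hSt (by rw [Matrix.mul_assoc, hQS', Matrix.mul_zero])]
    have h1 : lyapunovOp (D.A + -(D.B * (D.Rc Y)⁻¹ * (D.Lc Y)ᵀ)) (Fin.elim0 : Fin 0 → _) S =
        lyapunovOp D.A (Fin.elim0 : Fin 0 → _) S :=
      lyapunovOp_add_of_mul_eq_zero _ hSt
        (by rw [Matrix.neg_mul, Matrix.mul_assoc, hLc, Matrix.mul_zero, neg_zero])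
    rw [← h1, lyapunovOp_fin_zero, ← sub_eq_add_neg]
    rw [lyapunovOp_fin_zero] at hLS
    exact hLS

/-! ### The fixed-point iteration -/

theorem neg_ric_posSemidef_of_eq_zero {X : Matrix (Fin n) (Fin n) ℝ} (h : D.ric X = 0) :
    (-D.ric X).PosSemidef := by
  rw [h, neg_zero]; exact .zero

/-- A frozen equation has a positive semidefinite stabilizing solution, and every stabilizing
solution equals it. -/
theorem exists_frozen_solution (hR : D.R.PosDef) {Y : Matrix (Fin n) (Fin n) ℝ}
    (hY : Y.PosSemidef) (h : (D.frozen Y).Regular) :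
    ∃ X : Matrix (Fin n) (Fin n) ℝ, X.PosSemidef ∧ (D.frozen Y).ric X = 0 ∧
      IsStabilizingCARESolution (D.Ac Y) (D.Gc Y) (D.Hc Y) X ∧
      ∀ Z, IsStabilizingCARESolution (D.Ac Y) (D.Gc Y) (D.Hc Y) Z → Z = X := by
  obtain ⟨X, hX, hric⟩ := h.exists_ric_eq_zero
  have hXt := PosSemidef.transpose_eq hX
  have hstab := h.feedbackStable_gain hX (neg_ric_posSemidef_of_eq_zero hric)
  have hsol : IsStabilizingCARESolution (D.Ac Y) (D.Gc Y) (D.Hc Y) X := by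
    refine ⟨by rw [← frozen_ric_eq hR hXt hY, hric], ?_⟩
    rw [← frozen_closedLoop]
    exact isStable_of_lyapStable hstab
  refine ⟨X, hX, hric, hsol, fun Z hZ => hZ.unique ?_ ?_ hsol⟩
  · rw [Gc, Matrix.transpose_mul, Matrix.transpose_mul, Matrix.transpose_transpose,
      PosDef.transpose_eq (rc_posDef hR hY).inv, Matrix.mul_assoc]
  · exact PosSemidef.transpose_eq h.posSemidef

theorem existsUnique_isFPSDASeq (hR : D.R.PosDef)
    (hfr : ∀ Y : Matrix (Fin n) (Fin n) ℝ, Y.PosSemidef → (D.frozen Y).Regular) :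
    ∃! X : ℕ → Matrix (Fin n) (Fin n) ℝ, X 0 = 0 ∧ D.IsFPSDASeq X := by
  choose! φ h1 h2 h3 h4 using fun Y (hY : Y.PosSemidef) =>
    exists_frozen_solution hR hY (hfr Y hY)
  have hpsd : ∀ k : ℕ, (φ^[k] 0).PosSemidef := by
    intro k
    induction k with
    | zero => exact .zero
    | succ k ih => rw [Function.iterate_succ_apply']; exact h1 _ ih
  refine ⟨fun k => φ^[k] 0, ⟨rfl, fun k => ?_⟩, ?_⟩
  · have h5 := h3 _ (hpsd k)
    rwa [← Function.iterate_succ_apply' φ k] at h5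
  · rintro X ⟨hX0, hX⟩
    funext k
    induction k with
    | zero => exact hX0
    | succ k ih =>
      have h5 := hX k
      rw [ih] at h5
      rw [Function.iterate_succ_apply']
      exact h4 _ (hpsd k) _ h5

/-- A positive semidefinite limit of the iterates solves the Riccati equation. -/
theorem ric_eq_zero_of_tendsto (hR : D.R.PosDef) {X : ℕ → Matrix (Fin n) (Fin n) ℝ}
    {Z : Matrix (Fin n) (Fin n) ℝ} (hX : D.IsFPSDASeq X) (hZ : Z.PosSemidef)
    (hlim : Tendsto X atTop (𝓝 Z)) : D.ric Z = 0 := by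
  let g : Matrix (Fin n) (Fin n) ℝ × Matrix (Fin m) (Fin m) ℝ × Matrix (Fin n) (Fin n) ℝ →
      Matrix (Fin n) (Fin n) ℝ := fun p =>
    (D.A - D.B * p.2.1 * (D.Lc p.1)ᵀ)ᵀ * p.2.2 + p.2.2 * (D.A - D.B * p.2.1 * (D.Lc p.1)ᵀ)
      - p.2.2 * (D.B * p.2.1 * D.Bᵀ) * p.2.2 + (D.Qc p.1 - D.Lc p.1 * p.2.1 * (D.Lc p.1)ᵀ)
  have hg : Continuous g := by
    simp only [g, Lc, Qc, Pi11, Pi12]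
    fun_prop
  have h1 := hg.continuousAt.tendsto.comp (hlim.prodMk_nhds
    (((continuousAt_rc_inv hR hZ).tendsto.comp hlim).prodMk_nhds
      (hlim.comp (tendsto_add_atTop_nat 1))))
  have h2 : g (Z, (D.Rc Z)⁻¹, Z) = 0 := by
    refine tendsto_nhds_unique h1 (tendsto_const_nhds.congr fun k => ?_)
    exact (hX k).1.symm
  rw [← frozen_ric_self, frozen_ric_eq hR (PosSemidef.transpose_eq hZ) hZ]
  exact h2

theorem neg_frozen_ric_posSemidef (hR : D.R.PosDef) {X Y : Matrix (Fin n) (Fin n) ℝ}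
    (hX : X.PosSemidef) (hric : D.ric X = 0) (hY : Y.PosSemidef) (hYX : (X - Y).PosSemidef) :
    (-(D.frozen Y).ric X).PosSemidef := by
  have := frozen_ric_mono hR hX hY hX hYX
  rwa [frozen_ric_self, hric, zero_sub] at this

end Coeffs

end StochRiccati

open StochRiccati StochRiccati.Coeffs in
theorem mainTheorem1 {n m r p : ℕ} (D : StochRiccati.Coeffs n m r)
    (C : Matrix (Fin p) (Fin n) ℝ)
    (hR : D.R.PosDef)
    (hQLR : (Matrix.fromBlocks D.Q D.L D.Lᵀ D.R).PosSemidef)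
    (hstab : D.StochStabilizable)
    (hC : Cᵀ * C = D.Qhat)
    (hdet : D.StochDetectable C)
    (hker : ∀ v : Fin n → ℝ, D.Qhat *ᵥ v = 0 → D.Lᵀ *ᵥ v = 0 ∧ ∀ i, D.A₀ i *ᵥ v = 0)
    (hAB : StochRiccati.IsStabilizable D.A D.B)
    (hQA : StochRiccati.IsDetectable D.Qhat D.A) :
    ∃ Xs : Matrix (Fin n) (Fin n) ℝ,
      -- `Xs` is the unique positive semidefinite solution, and it is stabilizing
      Xs.PosSemidef ∧ D.ric Xs = 0 ∧
      (∀ Y : Matrix (Fin n) (Fin n) ℝ, Y.PosSemidef → D.ric Y = 0 → Y = Xs) ∧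
      D.ClosedLoopStable (D.gain Xs) ∧
      -- the iteration started at `0` is well defined
      (∃! X : ℕ → Matrix (Fin n) (Fin n) ℝ, X 0 = 0 ∧ D.IsFPSDASeq X) ∧
      -- its behaviour
      ∀ X : ℕ → Matrix (Fin n) (Fin n) ℝ, X 0 = 0 → D.IsFPSDASeq X →
        (∀ k, (X (k + 1) - X k).PosSemidef ∧ (Xs - X k).PosSemidef ∧
          (D.ric (X k)).PosSemidef ∧
          StochRiccati.IsStable (D.Ac (X k) - D.Gc (X k) * Xs)) ∧
        Tendsto X atTop (𝓝 Xs) ∧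
        ∀ z ∈ spectrum ℂ ((D.Ac Xs - D.Gc Xs * Xs).map (algebraMap ℝ ℂ)), z.re ≤ 0 := by
  have h : D.Regular := regular_of_stochDetectable hR hstab hC hdet
  have hfr : ∀ Y : Matrix (Fin n) (Fin n) ℝ, Y.PosSemidef → (D.frozen Y).Regular :=
    fun Y hY => h.frozen hker hAB hQA hY
  obtain ⟨Xs, hXs, hric⟩ := h.exists_ric_eq_zero
  -- `Xs` is a supersolution of every equation frozen below it, hence stabilizes it
  have hstable : ∀ Y : Matrix (Fin n) (Fin n) ℝ, Y.PosSemidef → (Xs - Y).PosSemidef →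
      IsStable (D.Ac Y - D.Gc Y * Xs) := fun Y hY hYX => by
    rw [← frozen_closedLoop]
    exact isStable_of_lyapStable
      ((hfr Y hY).feedbackStable_gain hXs (neg_frozen_ric_posSemidef hR hXs hric hY hYX))
  refine ⟨Xs, hXs, hric, fun Y hY hYric => h.eq_of_ric_eq_zero hY hXs hYric hric,
    LyapStable.isExpStable (h.feedbackStable_gain hXs (neg_ric_posSemidef_of_eq_zero hric)),
    existsUnique_isFPSDASeq hR hfr, fun X hX0 hX => ?_⟩
  have hstep : ∀ k, (X k).PosSemidef → (X (k + 1)).PosSemidef ∧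
      (D.frozen (X k)).ric (X (k + 1)) = 0 := fun k hk => by
    obtain ⟨Z, hZ, hZric, -, huniq⟩ := exists_frozen_solution hR hk (hfr _ hk)
    rw [huniq _ (hX k)]
    exact ⟨hZ, hZric⟩
  have hmono : ∀ k, (X k).PosSemidef → (D.ric (X k)).PosSemidef →
      (X (k + 1) - X k).PosSemidef := fun k hk hkric => by
    obtain ⟨h1, h2⟩ := hstep k hk
    exact (hfr _ hk).sub_posSemidef h1 hk (neg_ric_posSemidef_of_eq_zero h2)
      (by rwa [frozen_ric_self])
  have hinv : ∀ k, (X k).PosSemidef ∧ (Xs - X k).PosSemidef ∧ (D.ric (X k)).PosSemidef := by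
    intro k
    induction k with
    | zero =>
      rw [hX0, ric_zero, sub_zero]
      exact ⟨.zero, hXs, h.posSemidef⟩
    | succ k ih =>
      obtain ⟨hk, hkXs, hkric⟩ := ih
      obtain ⟨h1, h2⟩ := hstep k hk
      refine ⟨h1, ?_, ?_⟩
      · exact (hfr _ hk).sub_posSemidef hXs h1 (neg_frozen_ric_posSemidef hR hXs hric hk hkXs)
          (by rw [h2]; exact .zero)
      · have h3 := frozen_ric_mono hR h1 hk h1 (hmono k hk hkric)
        rwa [frozen_ric_self, h2, sub_zero] at h3
  refine ⟨fun k => ?_, ?_, fun z hz => (hstable Xs hXs (by rw [sub_self]; exact .zero) z hz).le⟩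
  · obtain ⟨hk, hkXs, hkric⟩ := hinv k
    exact ⟨hmono k hk hkric, hkXs, hkric, hstable _ hk hkXs⟩
  · obtain ⟨Y, -, hY⟩ := exists_tendsto_of_antitone (X := fun k => Xs - X k)
      (fun k => (hinv k).2.1) (fun k => by
        have := hmono k (hinv k).1 (hinv k).2.2
        rwa [← sub_sub_sub_cancel_left _ _ Xs] at this)
    have hlim : Tendsto X atTop (𝓝 (Xs - Y)) := by
      have := (tendsto_const_nhds (x := Xs)).sub hY
      simpa using this
    have hZ : (Xs - Y).PosSemidef :=
      isClosed_posSemidef.mem_of_tendsto hlim (Eventually.of_forall fun k => (hinv k).1)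
    rwa [h.eq_of_ric_eq_zero hZ hXs (ric_eq_zero_of_tendsto hR hX hZ hlim) hric] at hlim
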